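/- Let $d\ge 1$ and let $\mathbf R_d=\mathbb Z[u_1^{\pm1},\dots,u_d^{\pm1}]$. For $h=\sum_{\mathbf n}h_{\mathbf n}u^{\mathbf n}\in\mathbf R_d$ and a finite set $F\subset\mathbb Z^d$ let $\Delta^{h}=\Delta^{h,F}$ be the matrix $(h_{\mathbf i-\mathbf j})_{\mathbf i,\mathbf j\in F}$. A square integer matrix $A$ is a *toppling matrix* if $A_{\mathbf i\mathbf j}\le 0$ for $\mathbf i\ne \mathbf j$ and $\sum_{\mathbf j}A_{\mathbf i\mathbf j}>0$ for every $\mathbf i$. For such an $A$ indexed by $F$, a configuration $v\in\mathbb Z_{\ge 0}^F$ is *stable* if $v_{\mathbf i}<A_{\mathbf i\mathbf i}$ for all $\mathbf i$; a site with $v_{\mathbf i}\ge A_{\mathbf i\mathbf i}$ may topple, which replaces $v$ by $v-A_{\cdot\,\mathbf i}$; $S(v)$ is the stable configuration reached from $v$ by topplings, and $u\oplus v=S(u+v)$. The *recurrent* configurations are the stable $v$ such that for each stable $u$ there is a stable $w$ with $u\oplus w=v$; they form a finite abelian group under $\oplus$. Let $f,g\in\mathbf R_d$ have no common factor, put $h=fg$,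 and suppose that $\Delta'=\Delta^{g}\Delta^{f}$ is a toppling matrix for every finite $F\subset\mathbb Z^d$. Let $\mathcal R'_F$ be the group of recurrent configurations of $\Delta'$, let $\mathcal W_F=\{\Delta^{g}v\in\mathcal R'_F: v\in\mathbb Z^F\}$ (a subgroup), and let $\mu^{(g)}_F$ be the Haar probability measure of $\mathcal W_F$, regarded as a measure on $\mathbb Z^{\mathbb Z^d}$ by extending configurations by $0$ outside $F$. Let $\mathcal R^{(h)}$ be the set of all $v\in\{0,\dots,h_{\mathbf 0}-1\}^{\mathbb Z^d}$ such that every nonempty finite $E\subset\mathbb Z^d$ contains an $\mathbf i$ with $v_{\mathbf i}\ge-\sum_{\mathbf j\in E,\ \mathbf j\ne\mathbf i}h_{\mathbf i-\mathbf j}$, and let $\mathcal W^{(h)}_g=\{g\cdot u\in\mathcal R^{(h)}: u\in\ell^\infty(\mathbb Z^d,\mathbb Z)\}$, where $(g\cdot u)_{\mathbf n}=\sum_{\mathbf j}g_{\mathbf j}u_{\mathbf n-\mathbf j}$. Let $\sigma$, $(\sigma^{\mathbf m}v)_{\mathbf n}=v_{\mathbf n+\mathbf m}$, be the shift action, let $Q_N=\{-N,\dots,N\}^d$,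 and let $\mathrm h_{\mathrm{top}}(\sigma)=\lim_N|Q_N|^{-1}\log|\pi_{Q_N}(\mathcal W^{(h)}_g)|$ be the topological entropy of $\sigma$ on $\mathcal W^{(h)}_g$, where $\pi_{Q_N}$ is the restriction to $Q_N$. For a probability measure $\mu$ on $\mathbb Z^{\mathbb Z^d}$ let $\mathrm h_\mu(\sigma)=\lim_N|Q_N|^{-1}H_\mu\bigl(\bigvee_{\mathbf j\in Q_N}\sigma^{-\mathbf j}\zeta\bigr)$, where $\zeta$ is the (generating) partition according to the value of $v_{\mathbf 0}$ and $H_\mu$ is Shannon entropy. **Theorem.** Let $F_1,F_2,\dots\subset\mathbb Z^d$ be finite sets such that every finite subset of $\mathbb Z^d$ is contained in $F_k$ for all large $k$, and let $\mu^{(g)}$ be any weak accumulation point of the sequence $\mu^{(g)}_{F_k}$. Then the limits defining $\mathrm h_{\mathrm{top}}(\sigma)$ and $\mathrm h_{\mu^{(g)}}(\sigma)$ exist, $\mu^{(g)}(\mathcal W^{(h)}_g)=1$, and $$\mathrm h_{\mu^{(g)}}(\sigma)=\mathrm h_{\mathrm{top}}(\sigma).$$ If $\mu^{(g)}$ is $\sigma$-invariant,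 this number is its Kolmogorov–Sinai entropy (the supremum over all finite measurable partitions); and the Kolmogorov–Sinai entropy of any $\sigma$-invariant probability measure carried by $\mathcal W^{(h)}_g$ is at most $\mathrm h_{\mathrm{top}}(\sigma)$. Moreover $\lim_{N}|Q_N|^{-1}\log|\mathcal W_{Q_N}|$ exists and $$\mathrm h_{\mathrm{top}}(\sigma)\le\lim_{N\to\infty}\frac1{|Q_N|}\log|\mathcal W_{Q_N}|.$$ -/

import Mathlib

open MeasureTheory Filter Topology

/-- The lattice `ℤ^d`. -/
abbrev IntLattice (d : ℕ) : Type := Fin d → ℤ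

/-- Laurent polynomials in `d` variables with integer coefficients; the coefficient of `u^n`
in `h` is `h.coeff n`. -/
abbrev LaurentPoly (d : ℕ) : Type := AddMonoidAlgebra ℤ (IntLattice d)

/-- Integer configurations on the whole lattice, with the product topology and the product
(equivalently, Borel) σ-algebra. -/
abbrev Config (d : ℕ) : Type := IntLattice d → ℤ

/-- The cube `Q_N = {-N, …, N}^d`. -/
noncomputable def cube (d N : ℕ) : Finset (IntLattice d) :=
  Fintype.piFinset fun _ => Finset.Icc (-(N : ℤ)) (N : ℤ)

/-- The shift action `(σ^m v)_n = v_{n+m}`. -/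
def configShift {d : ℕ} (m : IntLattice d) (v : Config d) : Config d := fun n => v (n + m)

section Sandpile

variable {ι : Type*} [Fintype ι]

/-- Toppling matrices: nonpositive off the diagonal, with positive row sums. (In particular the
diagonal entries are positive.) -/
def IsTopplingMatrix (A : Matrix ι ι ℤ) : Prop :=
  (∀ i j, i ≠ j → A i j ≤ 0) ∧ ∀ i, 0 < ∑ j, A i j

/-- Stable configurations: `0 ≤ v_i < A_ii` at every site. -/
def IsStable (A : Matrix ι ι ℤ) (v : ι → ℤ) : Prop :=
  ∀ i, 0 ≤ v i ∧ v i < A i i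

/-- One legal toppling: a site `i` with `v_i ≥ A_ii` topples, the `i`-th column of `A` is
subtracted from `v`. -/
def Topples (A : Matrix ι ι ℤ) (v w : ι → ℤ) : Prop :=
  ∃ i, A i i ≤ v i ∧ w = fun j => v j - A j i

/-- The stabilisation `S(v)`: the stable configuration which is reached from `v` by legal
topplings. (For a toppling matrix and `v ≥ 0` it exists and is unique.) -/
noncomputable def stabilization (A : Matrix ι ι ℤ) (v : ι → ℤ) : ι → ℤ :=
  Classical.epsilon fun w => Relation.ReflTransGen (Topples A) v w ∧ IsStable A w

/-- The sandpile addition `u ⊕ v = S(u + v)`. -/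
noncomputable def sandAdd (A : Matrix ι ι ℤ) (u v : ι → ℤ) : ι → ℤ :=
  stabilization A (u + v)

/-- The recurrent configurations: the stable configurations which can be reached from every
stable configuration by adding a stable configuration and stabilising. This is the minimal ideal
of the finite commutative semigroup of stable configurations, an abelian group under `⊕`. -/
def recurrentSet (A : Matrix ι ι ℤ) : Set (ι → ℤ) :=
  {v | IsStable A v ∧ ∀ u, IsStable A u → ∃ w, IsStable A w ∧ sandAdd A u w = v}

/-- `m` is the Haar probability measure of the finite group `(W, ⊕)`: it is carried by `W` and
invariant under the translations `u ↦ u ⊕ w`, `w ∈ W`. -/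
def IsSandpileHaar (A : Matrix ι ι ℤ) (W : Set (ι → ℤ)) (m : ProbabilityMeasure (ι → ℤ)) :
    Prop :=
  (m : Measure (ι → ℤ)) Wᶜ = 0 ∧
    ∀ w ∈ W, (m : Measure (ι → ℤ)).map (fun u => sandAdd A u w) = m

end Sandpile

/-- The matrix `Δ^h` on `F`, `Δ^h_{ij} = h_{i-j}`. -/
def latticeMatrix {d : ℕ} (h : LaurentPoly d) (F : Finset (IntLattice d)) : Matrix F F ℤ :=
  Matrix.of fun i j => h.coeff ((i : IntLattice d) - (j : IntLattice d))

/-- The matrix `Δ' = Δ^g Δ^f` on `F`. -/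
def productMatrix {d : ℕ} (f g : LaurentPoly d) (F : Finset (IntLattice d)) : Matrix F F ℤ :=
  latticeMatrix g F * latticeMatrix f F

/-- The group `W_F` of multiples of `Δ^g` among the recurrent configurations of `Δ' = Δ^g Δ^f`. -/
def finiteW {d : ℕ} (f g : LaurentPoly d) (F : Finset (IntLattice d)) : Set (F → ℤ) :=
  {w | w ∈ recurrentSet (productMatrix f g F) ∧
    ∃ v : F → ℤ, w = (latticeMatrix g F).mulVec v}

/-- The abelian sandpile model `R^{(h)}` in infinite volume, defined by the burning algorithm. -/
def sandpileModel {d : ℕ} (h : LaurentPoly d) : Set (Config d) :=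
  {v | (∀ i, 0 ≤ v i ∧ v i < h.coeff 0) ∧
    ∀ E : Finset (IntLattice d), E.Nonempty →
      ∃ i ∈ E, -(∑ j ∈ E.erase i, h.coeff (i - j)) ≤ v i}

/-- The product `(g · u)_n = ∑_j g_j u_{n-j}`. -/
def polyMul {d : ℕ} (g : LaurentPoly d) (u : Config d) : Config d :=
  fun n => ∑ j ∈ g.coeff.support, g.coeff j * u (n - j)

/-- The subshift `W_g^{(h)}` for `h = f g`: the points of `R^{(h)}` of the form `g · u` with a
bounded integer configuration `u`. -/
def subshiftW {d : ℕ} (f g : LaurentPoly d) : Set (Config d) :=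
  {w | w ∈ sandpileModel (f * g) ∧
    ∃ u : Config d, (∃ C : ℤ, ∀ n, |u n| ≤ C) ∧ w = polyMul g u}

/-- A configuration on `F` seen as a configuration on the lattice, zero outside `F`. -/
noncomputable def extendZero {d : ℕ} (F : Finset (IntLattice d)) (u : F → ℤ) : Config d :=
  fun n => if h : n ∈ F then u ⟨n, h⟩ else 0

theorem measurable_extendZero {d : ℕ} (F : Finset (IntLattice d)) : Measurable (extendZero F) := by
  refine measurable_pi_lambda _ fun n => ?_
  by_cases h : n ∈ F
  · simpa only [extendZero, h, dif_pos] using measurable_pi_apply (⟨n, h⟩ : F)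
  · simp [extendZero, h]

/-- A measure on configurations on `F` seen as a measure on configurations on the lattice. -/
noncomputable def extendMeasure {d : ℕ} (F : Finset (IntLattice d))
    (m : ProbabilityMeasure (F → ℤ)) : ProbabilityMeasure (Config d) :=
  m.map (measurable_extendZero F).aemeasurable

/-- The topological entropy of the shift on a subshift `Y` over a finite alphabet is `r`:
the number of patterns of `Y` on `Q_N` grows with rate `r`. -/
def IsTopologicalEntropy {d : ℕ} (Y : Set (Config d)) (r : ℝ) : Prop :=
  Tendsto (fun N : ℕ =>
    Real.log (((fun (v : Config d) (j : cube d N) => v j) '' Y).ncard : ℝ) / (cube d N).card)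
    atTop (𝓝 r)

/-- The Shannon entropy `H_μ(⋁_{j ∈ Q_N} σ^{-j} ζ)` for the partition `ζ` into the level sets of
`P`. -/
noncomputable def partitionEntropy {d : ℕ} {α : Type*} (μ : Measure (Config d))
    (P : Config d → α) (N : ℕ) : ℝ :=
  ∑' a : cube d N → α, Real.negMulLog (μ.real {v | ∀ j : cube d N, P (configShift j v) = a j})

/-- The entropy `lim_N |Q_N|⁻¹ H_μ(⋁_{j ∈ Q_N} σ^{-j} ζ)` of the partition `ζ` exists and is
`r`. -/
def IsEntropyRate {d : ℕ} {α : Type*} (μ : Measure (Config d)) (P : Config d → α) (r : ℝ) :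
    Prop :=
  Tendsto (fun N : ℕ => partitionEntropy μ P N / (cube d N).card) atTop (𝓝 r)

/-- Invariance under the shift action. -/
def IsShiftInvariant {d : ℕ} (μ : Measure (Config d)) : Prop :=
  ∀ m : IntLattice d, μ.map (configShift m) = μ

/-- The Kolmogorov–Sinai entropy of the shift action with respect to an invariant measure `μ`
is `r`: the supremum of the entropies of all finite measurable partitions. -/
def IsKSEntropy {d : ℕ} (μ : Measure (Config d)) (r : ℝ) : Prop :=
  IsLUB {s | ∃ (k : ℕ) (P : Config d → Fin k), Measurable P ∧ IsEntropyRate μ P s} r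

/-! A toppling matrix obeys a maximum principle: integral row sums are at least 1, so a bound on `A
x` bounds `x` by the same constant. Combined with Dhar's burning condition it makes two stable
burning configurations equal as soon as they are congruent modulo the toppling lattice. Hence
`finiteW f g F` has one element in each class of Δ^g ℤ^F modulo Δ' ℤ^F, and it is bounded, with its
preimages under Δ^g, uniformly in `F`. By compactness, elements of `finiteW` for large `F` look
locally like points of `subshiftW`.

The heart is a surgery (`ncard_extensions_mul_le`). Take w in W_F showing a fixed pattern on Q and a
subshift pattern b = g·u on Q; add Δ^g of u cut off to Q, and pass to the recurrent representative
z. Then z, the toppling numbers and b, the latter two only near the boundary of Q, determine (w, b):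
inside Q the configurations differ by a multiple of h with zero boundary values, so burning
uniqueness applies. Thus every pattern has mass at most exp(O(|∂Q|)) divided by the number of
patterns, which forces the entropy rate of the limit measure up to the topological entropy. A
reverse surgery (`ncard_finiteW_le`) shows that |W_Q| has the same growth rate.

Kolmogorov–Sinai entropies are bounded by applying Gibbs' inequality to a noisy model of the names
of an approximating window partition (`partitionEntropy_le_of_approx`). -/

theorem Topples.add_right {ι : Type*} {A : Matrix ι ι ℤ} {v w : ι → ℤ}
    (h : Relation.ReflTransGen (Topples A) v w)
    {c : ι → ℤ} (hc : 0 ≤ c) : Relation.ReflTransGen (Topples A) (v + c) (w + c) := by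
  refine h.lift (· + c) fun a b hab => ?_
  obtain ⟨i, hi, rfl⟩ := hab
  refine ⟨i, ?_, ?_⟩
  · have := hc i
    simp only [Pi.add_apply, Pi.zero_apply] at *
    linarith
  · ext j
    simp only [Pi.add_apply]
    ring

theorem IsStable.nonneg {ι : Type*} {A : Matrix ι ι ℤ} {v : ι → ℤ} (h : IsStable A v) : 0 ≤ v := fun i => (h i).1

/-! ### Sandpiles of a single toppling matrix: maximum principle, burning, recurrence. -/

section AbstractSandpile

variable {ι : Type*} [Fintype ι] {A : Matrix ι ι ℤ}

/-- The burning condition: no set of sites carries a forbidden subconfiguration. -/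
def Burns [DecidableEq ι] (A : Matrix ι ι ℤ) (v : ι → ℤ) : Prop :=
  ∀ E : Finset ι, E.Nonempty → ∃ i ∈ E, -(∑ j ∈ E.erase i, A i j) ≤ v i

/-- Maximum principle: at a maximiser k of `x` the signs off the diagonal give (A x)_k ≥ (row
sum)·x_k, and the row sum is an integer ≥ 1. -/
theorem IsTopplingMatrix.le_of_mulVec_le (hA : IsTopplingMatrix A) {x : ι → ℤ} {c : ℤ}
    (hc : 0 ≤ c) (h : ∀ i, A.mulVec x i ≤ c) (i : ι) : x i ≤ c := by
  classical
  obtain ⟨k, -, hk⟩ := Finset.exists_max_image Finset.univ x ⟨i, Finset.mem_univ i⟩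
  refine (hk i (Finset.mem_univ i)).trans ?_
  by_contra! hlt
  have h1 : (∑ j, A k j) * x k ≤ A.mulVec x k := by
    rw [Matrix.mulVec, dotProduct, Finset.sum_mul]
    refine Finset.sum_le_sum fun j _ => ?_
    rcases eq_or_ne k j with rfl | hkj
    · exact le_rfl
    · exact mul_le_mul_of_nonpos_left (hk j (Finset.mem_univ j)) (hA.1 k j hkj)
  have h2 := h k
  have h3 := hA.2 k
  nlinarith

theorem IsTopplingMatrix.abs_le_of_abs_mulVec_le (hA : IsTopplingMatrix A) {x : ι → ℤ} {c : ℤ}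
    (h : ∀ i, |A.mulVec x i| ≤ c) (i : ι) : |x i| ≤ c := by
  have hc : 0 ≤ c := (abs_nonneg _).trans (h i)
  refine abs_le.2 ⟨?_, hA.le_of_mulVec_le hc (fun i => (abs_le.1 (h i)).2) i⟩
  have := hA.le_of_mulVec_le (x := -x) hc
    (fun i => by rw [Matrix.mulVec_neg, Pi.neg_apply]; linarith [(abs_le.1 (h i)).1]) i
  rw [Pi.neg_apply] at this
  linarith

theorem IsTopplingMatrix.det_ne_zero [DecidableEq ι] (hA : IsTopplingMatrix A) : A.det ≠ 0 := by
  intro h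
  obtain ⟨v, hv, hv0⟩ := Matrix.exists_mulVec_eq_zero_iff.2 h
  refine hv (funext fun i => ?_)
  have := hA.abs_le_of_abs_mulVec_le (x := v) (c := 0) (fun i => by simp [hv0]) i
  simpa using this

theorem IsTopplingMatrix.diag_pos (hA : IsTopplingMatrix A) (i : ι) : 0 < A i i := by
  classical
  have h := hA.2 i
  rw [← Finset.add_sum_erase _ _ (Finset.mem_univ i)] at h
  have : ∑ j ∈ Finset.univ.erase i, A i j ≤ 0 :=
    Finset.sum_nonpos fun j hj => hA.1 i j (Finset.ne_of_mem_erase hj).symm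
  linarith

/-- Two configurations which differ by an element of the toppling lattice: the toppling numbers
are nonpositive if the first one is stable and the second one burns. -/
theorem IsTopplingMatrix.nonpos_of_burns [DecidableEq ι] (hA : IsTopplingMatrix A)
    {v w n : ι → ℤ} (hv : ∀ i, v i < A i i) (hw : Burns A w) (h : v - w = A.mulVec n) (i : ι) :
    n i ≤ 0 := by
  obtain ⟨k, -, hk⟩ := Finset.exists_max_image Finset.univ n ⟨i, Finset.mem_univ i⟩
  refine (hk i (Finset.mem_univ i)).trans ?_
  by_contra! hpos
  -- Burning is applied to the set where `n` is maximal. Off this set `n` drops by at least 1, so if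
  -- the maximum were positive, adding `A n` to `w` at `l` would lift it to at least `A l l`,
  -- against stability of `v`.
  obtain ⟨l, hl, hwl⟩ := hw (Finset.univ.filter fun j => n j = n k) ⟨k, by simp⟩
  set E := Finset.univ.filter fun j => n j = n k with hE
  have hnl : n l = n k := (Finset.mem_filter.1 hl).2
  have h1 : (∑ j, A l j) * (n k - 1) + ∑ j ∈ E, A l j ≤ A.mulVec n l := by
    have h2 : ∑ j ∈ E, A l j = ∑ j, if n j = n k then A l j else 0 := by
      rw [hE, Finset.sum_filter]
    rw [h2, Finset.sum_mul, ← Finset.sum_add_distrib, Matrix.mulVec, dotProduct]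
    refine Finset.sum_le_sum fun j _ => ?_
    split_ifs with hj
    · rw [hj]; linarith
    · have h3 : n j ≤ n k - 1 := by
        have := lt_of_le_of_ne (hk j (Finset.mem_univ j)) hj
        omega
      have h4 : l ≠ j := fun h => hj (h ▸ hnl)
      rw [add_zero]
      exact mul_le_mul_of_nonpos_left h3 (hA.1 l j h4)
  have h5 := congrFun h l
  rw [Pi.sub_apply] at h5
  rw [← Finset.add_sum_erase _ _ hl] at h1
  have h6 : 0 ≤ (∑ j, A l j) * (n k - 1) := mul_nonneg (hA.2 l).le (by linarith)
  linarith [hv l]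

theorem IsTopplingMatrix.eq_zero_of_burns [DecidableEq ι] (hA : IsTopplingMatrix A)
    {v w n : ι → ℤ} (hv : ∀ i, v i < A i i) (hw : ∀ i, w i < A i i) (hv' : Burns A v)
    (hw' : Burns A w) (h : v - w = A.mulVec n) : n = 0 := by
  funext i
  have h1 := hA.nonpos_of_burns hv hw' h i
  have h2 := hA.nonpos_of_burns (n := -n) hw hv' (by rw [Matrix.mulVec_neg, ← h, neg_sub]) i
  rw [Pi.neg_apply] at h2
  rw [Pi.zero_apply]
  linarith

theorem Topples.nonneg (hA : IsTopplingMatrix A) {v w : ι → ℤ} (h : Topples A v w)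
    (hv : 0 ≤ v) : 0 ≤ w := by
  obtain ⟨i, hi, rfl⟩ := h
  intro j
  have := hv j
  rcases eq_or_ne j i with rfl | hj
  · simpa using hi
  · have := hA.1 j i hj
    simp only [Pi.zero_apply] at *
    linarith

theorem Topples.exists_eq_sub_mulVec {v w : ι → ℤ} (h : Relation.ReflTransGen (Topples A) v w) :
    ∃ n, w = v - A.mulVec n := by
  classical
  induction h with
  | refl => exact ⟨0, by simp⟩
  | tail _ h ih =>
    obtain ⟨n, rfl⟩ := ih
    obtain ⟨i, -, rfl⟩ := h
    refine ⟨n + Pi.single i 1, ?_⟩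
    ext j
    simp [Matrix.mulVec_add, sub_sub]

/-- Termination: as long as v - A n ≥ 0, the maximum principle bounds `n`, while each toppling
raises ∑ n by one. -/
theorem IsTopplingMatrix.exists_stabilization (hA : IsTopplingMatrix A) {v : ι → ℤ}
    (hv : 0 ≤ v) : ∃ w, Relation.ReflTransGen (Topples A) v w ∧ IsStable A w := by
  classical
  obtain ⟨c, hc⟩ : ∃ c : ℤ, ∀ i, v i ≤ c := by
    obtain ⟨c, hc⟩ := (Set.finite_range v).bddAbove
    exact ⟨c, fun i => hc ⟨i, rfl⟩⟩
  have key : ∀ (k : ℕ) (n : ι → ℤ), Relation.ReflTransGen (Topples A) v (v - A.mulVec n) →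
      0 ≤ v - A.mulVec n → Fintype.card ι * max c 0 - ∑ i, n i < k →
      ∃ w, Relation.ReflTransGen (Topples A) v w ∧ IsStable A w := by
    intro k
    induction k with
    | zero =>
      intro n _ h0 hk
      have h1 : ∀ i, n i ≤ max c 0 := hA.le_of_mulVec_le (le_max_right _ _) fun i => by
        have := h0 i
        simp only [Pi.zero_apply, Pi.sub_apply] at this
        exact (sub_nonneg.1 this).trans ((hc i).trans (le_max_left _ _))
      have h2 : ∑ i, n i ≤ Fintype.card ι * max c 0 := by
        simpa using Finset.sum_le_sum fun i (_ : i ∈ Finset.univ) => h1 i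
      push_cast at hk
      linarith
    | succ k ih =>
      intro n hn h0 hk
      by_cases hs : IsStable A (v - A.mulVec n)
      · exact ⟨_, hn, hs⟩
      obtain ⟨i, hi⟩ : ∃ i, A i i ≤ (v - A.mulVec n) i := by
        by_contra! hcon
        exact hs fun i => ⟨h0 i, hcon i⟩
      have htop : Topples A (v - A.mulVec n) (v - A.mulVec (n + Pi.single i 1)) := by
        refine ⟨i, hi, ?_⟩
        ext j
        simp [Matrix.mulVec_add, sub_sub]
      refine ih _ (hn.tail htop) (htop.nonneg hA h0) ?_
      push_cast at hk
      simp only [Pi.add_apply, Finset.sum_add_distrib, Finset.sum_pi_single', Finset.mem_univ,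
        if_true]
      linarith
  obtain ⟨k, hk⟩ := exists_nat_gt (Fintype.card ι * max c 0 : ℤ)
  exact key k 0 (by simpa using Relation.ReflTransGen.refl) (by simpa using hv)
    (by simpa using hk)

theorem IsTopplingMatrix.stabilization_spec (hA : IsTopplingMatrix A) {v : ι → ℤ} (hv : 0 ≤ v) :
    Relation.ReflTransGen (Topples A) v (stabilization A v) ∧ IsStable A (stabilization A v) :=
  Classical.epsilon_spec (hA.exists_stabilization hv)

/-- Dhar's burning criterion: a stable configuration which is reached by topplings at all sites
contains no forbidden subconfiguration. -/
theorem IsTopplingMatrix.burns_of_reach [DecidableEq ι] (hA : IsTopplingMatrix A) {b v : ι → ℤ}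
    (hb : ∀ i, A i i ≤ b i) (h : Relation.ReflTransGen (Topples A) b v) (hv : IsStable A v) :
    Burns A v := by
  -- `T` collects the sites that have toppled. A site outside `T` has only gained grains; when `k`
  -- topples, any other site that burns in `E.erase k` receives exactly the extra amount that
  -- burning in `E` requires. Stability at the end leaves no site outside `T`.
  have key : 0 ≤ v ∧ ∃ T : Finset ι, (∀ i ∉ T, A i i ≤ v i) ∧ ∀ E : Finset ι, E.Nonempty →
      E ⊆ T → ∃ i ∈ E, -(∑ j ∈ E.erase i, A i j) ≤ v i := by
    clear hv
    induction h with
    | refl =>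
      refine ⟨fun i => (hA.diag_pos i).le.trans (hb i), ∅, fun i _ => hb i, fun E hE hE' => ?_⟩
      rw [Finset.subset_empty.1 hE'] at hE
      exact absurd hE Finset.not_nonempty_empty
    | tail _ h ih =>
      obtain ⟨h0, T, hT, hE⟩ := ih
      have h0' := h.nonneg hA h0
      obtain ⟨k, hk, rfl⟩ := h
      refine ⟨h0', insert k T, fun i hi => ?_, fun E hne hEs => ?_⟩
      · rw [Finset.mem_insert, not_or] at hi
        have := hA.1 i k hi.1
        have := hT i hi.2
        linarith
      · by_cases hkE : k ∈ E
        · rcases (E.erase k).eq_empty_or_nonempty with he | hne'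
          · exact ⟨k, hkE, by rw [he]; simpa using h0' k⟩
          · obtain ⟨i, hi, hle⟩ := hE (E.erase k) hne' fun j hj => by
              rcases Finset.mem_insert.1 (hEs (Finset.mem_of_mem_erase hj)) with rfl | h
              · exact absurd rfl (Finset.ne_of_mem_erase hj)
              · exact h
            refine ⟨i, Finset.mem_of_mem_erase hi, ?_⟩
            have hk' : k ∈ E.erase i :=
              Finset.mem_erase.2 ⟨(Finset.ne_of_mem_erase hi).symm, hkE⟩
            rw [← Finset.add_sum_erase _ _ hk', Finset.erase_right_comm]
            linarith
        · obtain ⟨i, hi, hle⟩ := hE E hne fun j hj => by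
            rcases Finset.mem_insert.1 (hEs hj) with rfl | h
            · exact absurd hj hkE
            · exact h
          refine ⟨i, hi, hle.trans ?_⟩
          have := hA.1 i k fun h => hkE (h ▸ hi)
          linarith
  obtain ⟨-, T, hT, hE⟩ := key
  intro E hne
  refine hE E hne fun i _ => ?_
  by_contra hi
  exact absurd (hT i hi) (not_le.2 (hv i).2)

/-- Apply recurrence to the stabilisation u of the diagonal: v = S(u + w) is then reached from the
diagonal plus w. -/
theorem IsTopplingMatrix.exists_reach_of_mem_recurrentSet (hA : IsTopplingMatrix A) {v : ι → ℤ}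
    (hv : v ∈ recurrentSet A) :
    ∃ b, (∀ i, A i i ≤ b i) ∧ Relation.ReflTransGen (Topples A) b v := by
  have hd : (0 : ι → ℤ) ≤ fun i => A i i := fun i => (hA.diag_pos i).le
  obtain ⟨h1, h2⟩ := hA.stabilization_spec hd
  obtain ⟨w, hw, rfl⟩ := hv.2 _ h2
  refine ⟨(fun i => A i i) + w, fun i => ?_, (Topples.add_right h1 hw.nonneg).trans ?_⟩
  · have := (hw i).1
    simp only [Pi.add_apply]
    linarith
  · exact (hA.stabilization_spec (add_nonneg h2.nonneg hw.nonneg)).1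

theorem IsTopplingMatrix.burns_of_mem_recurrentSet [DecidableEq ι] (hA : IsTopplingMatrix A)
    {v : ι → ℤ} (hv : v ∈ recurrentSet A) : Burns A v := by
  obtain ⟨b, hb, h⟩ := hA.exists_reach_of_mem_recurrentSet hv
  exact hA.burns_of_reach hb h hv.1

theorem IsTopplingMatrix.eq_of_burns (hA : IsTopplingMatrix A) [DecidableEq ι]
    {v w n : ι → ℤ} (hv : IsStable A v) (hw : IsStable A w) (hv' : Burns A v) (hw' : Burns A w)
    (h : v - w = A.mulVec n) : v = w := by
  have := hA.eq_zero_of_burns (fun i => (hv i).2) (fun i => (hw i).2) hv' hw' h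
  rw [this, Matrix.mulVec_zero] at h
  exact sub_eq_zero.1 h

/-- Every class of the toppling lattice contains a recurrent configuration. -/
theorem IsTopplingMatrix.exists_recurrent (hA : IsTopplingMatrix A) (x : ι → ℤ) :
    ∃ v ∈ recurrentSet A, ∃ n, v = x - A.mulVec n := by
  classical
  obtain ⟨t, ht0, ht⟩ : ∃ t : ℤ, 0 ≤ t ∧ ∀ i, A i i - x i ≤ t := by
    obtain ⟨c, hc⟩ := (Set.finite_range fun i => A i i - x i).bddAbove
    exact ⟨max c 0, le_max_right _ _, fun i => (hc ⟨i, rfl⟩).trans (le_max_left _ _)⟩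
  -- Adding `A` applied to the constant `t` stays in the class and lifts every site by at least `t`,
  -- hence above the diagonal.
  set b : ι → ℤ := x + A.mulVec (fun _ => t) with hb
  have hbd : ∀ i, A i i ≤ b i := fun i => by
    have h1 : A.mulVec (fun _ => t) i = (∑ j, A i j) * t := by
      rw [Matrix.mulVec, dotProduct, Finset.sum_mul]
    rw [hb, Pi.add_apply, h1]
    nlinarith [ht i, hA.2 i]
  have hb0 : 0 ≤ b := fun i => (hA.diag_pos i).le.trans (hbd i)
  obtain ⟨h1, h2⟩ := hA.stabilization_spec hb0
  refine ⟨stabilization A b, ⟨h2, fun u hu => ?_⟩, ?_⟩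
  · have hz : 0 ≤ b - u := fun i => sub_nonneg.2 ((hu i).2.le.trans (hbd i))
    obtain ⟨h3, h4⟩ := hA.stabilization_spec hz
    refine ⟨stabilization A (b - u), h4, ?_⟩
    have h5 := Topples.add_right h3 hu.nonneg
    rw [sub_add_cancel, add_comm] at h5
    obtain ⟨h6, h7⟩ := hA.stabilization_spec (add_nonneg hu.nonneg h4.nonneg)
    have h8 := h5.trans h6
    obtain ⟨n, hn⟩ := Topples.exists_eq_sub_mulVec h8
    obtain ⟨n', hn'⟩ := Topples.exists_eq_sub_mulVec h1
    -- Both stabilisations are reached from `b`, so both burn and are congruent; uniqueness does the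
    -- work of the abelian property of topplings.
    refine hA.eq_of_burns (n := n' - n) h7 h2 (hA.burns_of_reach hbd h8 h7)
      (hA.burns_of_reach hbd h1 h2) ?_
    rw [sandAdd, hn, hn', Matrix.mulVec_sub]
    abel
  · obtain ⟨n, hn⟩ := Topples.exists_eq_sub_mulVec h1
    refine ⟨n - fun _ => t, ?_⟩
    rw [hn, Matrix.mulVec_sub, hb]
    abel

/-- A recurrent configuration plus a stable one stabilises to the recurrent configuration of the
class of the sum. -/
theorem IsTopplingMatrix.sandAdd_eq (hA : IsTopplingMatrix A) {x w y n : ι → ℤ}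
    (hx : x ∈ recurrentSet A) (hw : IsStable A w) (hy : y ∈ recurrentSet A)
    (h : y = x + w - A.mulVec n) : sandAdd A x w = y := by
  classical
  obtain ⟨b, hb, hbx⟩ := hA.exists_reach_of_mem_recurrentSet hx
  obtain ⟨h1, h2⟩ := hA.stabilization_spec (add_nonneg hx.1.nonneg hw.nonneg)
  obtain ⟨n', hn'⟩ := Topples.exists_eq_sub_mulVec h1
  refine hA.eq_of_burns (n := n - n') h2 hy.1 (hA.burns_of_reach (b := b + w) (fun i => ?_)
    ((Topples.add_right hbx hw.nonneg).trans h1) h2) (hA.burns_of_mem_recurrentSet hy) ?_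
  · have := (hw i).1
    have := hb i
    simp only [Pi.add_apply]
    linarith
  · rw [sandAdd, hn', h, Matrix.mulVec_sub]
    abel

theorem finite_setOf_isStable (A : Matrix ι ι ℤ) : {v : ι → ℤ | IsStable A v}.Finite := by
  refine (Set.Finite.pi' fun i => Set.finite_Ico 0 (A i i)).subset fun v hv i => ?_
  exact ⟨(hv i).1, (hv i).2⟩

/-- An invariant probability measure on a finite set of configurations on which sandpile addition
is transitive is equidistributed. -/
theorem IsSandpileHaar.real_mul_ncard {W : Set (ι → ℤ)} (hW : W.Finite)
    (htrans : ∀ x ∈ W, ∀ y ∈ W, ∃ w ∈ W, sandAdd A x w = y) {m : ProbabilityMeasure (ι → ℤ)}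
    (hm : IsSandpileHaar A W m) (S : Set (ι → ℤ)) :
    (m : Measure (ι → ℤ)).real S * W.ncard = (S ∩ W).ncard := by
  classical
  -- Adding a suitable `w` sends `x` to `y`, so the preimage of {y} contains `x`. Using this in both
  -- directions gives equal masses without injectivity of translations.
  have hle : ∀ x ∈ W, ∀ y ∈ W,
      (m : Measure (ι → ℤ)).real {x} ≤ (m : Measure (ι → ℤ)).real {y} := by
    intro x hx y hy
    obtain ⟨w, hw, rfl⟩ := htrans x hx y hy
    conv_rhs => rw [← hm.2 w hw]
    rw [map_measureReal_apply (measurable_of_countable _) (measurableSet_singleton _)]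
    exact measureReal_mono (by simp)
  have hsum : ∀ T : Set (ι → ℤ), T ⊆ W → ∀ x ∈ W,
      (m : Measure (ι → ℤ)).real T = T.ncard * (m : Measure (ι → ℤ)).real {x} := by
    intro T hT x hx
    have hTf := hW.subset hT
    rw [Set.ncard_eq_toFinset_card T hTf]
    nth_rewrite 1 [← hTf.coe_toFinset]
    rw [← sum_measureReal_singleton, ← nsmul_eq_mul, ← Finset.sum_const]
    refine Finset.sum_congr rfl fun y hy => ?_
    have hy' := hT (hTf.mem_toFinset.1 hy)
    exact le_antisymm (hle y hy' x hx) (hle x hx y hy')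
  have hW1 : (m : Measure (ι → ℤ)).real W = 1 := by
    rw [measureReal_def, (prob_compl_eq_zero_iff hW.measurableSet).1 hm.1, ENNReal.toReal_one]
  have hSW : (m : Measure (ι → ℤ)).real S = (m : Measure (ι → ℤ)).real (S ∩ W) := by
    rw [measureReal_def, measureReal_def, measure_inter_conull hm.1]
  rcases W.eq_empty_or_nonempty with rfl | ⟨x, hx⟩
  · simp
  rw [hSW, hsum _ Set.inter_subset_right x hx, mul_assoc, mul_comm _ (W.ncard : ℝ),
    ← hsum W le_rfl x hx, hW1, mul_one]

end AbstractSandpile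

/-! ### Finite and infinite volume: comparison of the matrices, uniform bounds, compactness. -/

section Lattice

variable {d : ℕ}

/-- The sum of the absolute values of the coefficients. -/
noncomputable def coeffNorm (h : LaurentPoly d) : ℤ := ∑ j ∈ h.coeff.support, |h.coeff j|

theorem coeffNorm_nonneg (h : LaurentPoly d) : 0 ≤ coeffNorm h :=
  Finset.sum_nonneg fun _ _ => abs_nonneg _

theorem abs_polyMul_le {h : LaurentPoly d} {u : Config d} {C : ℤ} (hu : ∀ n, |u n| ≤ C)
    (n : IntLattice d) : |polyMul h u n| ≤ coeffNorm h * C := by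
  rw [polyMul, coeffNorm, Finset.sum_mul]
  refine (Finset.abs_sum_le_sum_abs _ _).trans (Finset.sum_le_sum fun j _ => ?_)
  rw [abs_mul]
  exact mul_le_mul_of_nonneg_left (hu _) (abs_nonneg _)

theorem polyMul_neg (h : LaurentPoly d) (u : Config d) : polyMul h (-u) = -polyMul h u := by
  ext n
  simp [polyMul]

theorem polyMul_congr {h : LaurentPoly d} {u v : Config d} {n : IntLattice d}
    (huv : ∀ j, h.coeff (n - j) ≠ 0 → u j = v j) : polyMul h u n = polyMul h v n := by
  refine Finset.sum_congr rfl fun j hj => ?_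
  rw [huv (n - j) (by simpa using hj)]

theorem polyMul_eq_sum {h : LaurentPoly d} {u : Config d} {n : IntLattice d}
    {s : Finset (IntLattice d)} (hs : ∀ j, h.coeff (n - j) ≠ 0 → j ∉ s → u j = 0) :
    polyMul h u n = ∑ j ∈ s, h.coeff (n - j) * u j := by
  classical
  have h1 : ∑ j ∈ s, h.coeff (n - j) * u j =
      ∑ j ∈ s ∪ h.coeff.support.image (fun j => n - j), h.coeff (n - j) * u j := by
    refine Finset.sum_subset Finset.subset_union_left fun j _ hj => ?_
    by_cases h0 : h.coeff (n - j) = 0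
    · rw [h0, zero_mul]
    · rw [hs j h0 hj, mul_zero]
  have h2 : ∑ j ∈ h.coeff.support.image (fun j => n - j), h.coeff (n - j) * u j =
      ∑ j ∈ s ∪ h.coeff.support.image (fun j => n - j), h.coeff (n - j) * u j := by
    refine Finset.sum_subset Finset.subset_union_right fun j _ hj => ?_
    have : h.coeff (n - j) = 0 := by
      by_contra h0
      exact hj (Finset.mem_image.2 ⟨n - j, by simpa using h0, by simp⟩)
    rw [this, zero_mul]
  rw [h1, ← h2, Finset.sum_image (by intro a _ b _ hab; simpa using hab), polyMul]
  simp

theorem polyMul_mul (g f : LaurentPoly d) (u : Config d) :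
    polyMul (g * f) u = polyMul g (polyMul f u) := by
  classical
  ext n
  have hsum : ∀ (p : LaurentPoly d) (u : Config d) (n : IntLattice d),
      polyMul p u n = p.coeff.sum fun j c => c * u (n - j) := fun _ _ _ => rfl
  rw [hsum, hsum g, AddMonoidAlgebra.mul_def, AddMonoidAlgebra.coeff_finsuppSum,
    Finsupp.sum_sum_index (by simp) (by intros; ring)]
  refine Finset.sum_congr rfl fun i _ => ?_
  beta_reduce
  rw [AddMonoidAlgebra.coeff_finsuppSum, Finsupp.sum_sum_index (by simp) (by intros; ring), hsum,
    Finsupp.mul_sum]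
  refine Finset.sum_congr rfl fun j _ => ?_
  beta_reduce
  rw [AddMonoidAlgebra.coeff_single, Finsupp.sum_single_index (by simp), ← sub_sub, mul_assoc]

theorem extendZero_apply {F : Finset (IntLattice d)} (x : F → ℤ) (i : F) :
    extendZero F x i = x i := by
  simp [extendZero]

theorem extendZero_of_notMem {F : Finset (IntLattice d)} (x : F → ℤ) {i : IntLattice d}
    (hi : i ∉ F) : extendZero F x i = 0 := by
  simp [extendZero, hi]

theorem abs_extendZero_le {F : Finset (IntLattice d)} {x : F → ℤ} {C : ℤ} (hC : 0 ≤ C)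
    (hx : ∀ i, |x i| ≤ C) (n : IntLattice d) : |extendZero F x n| ≤ C := by
  by_cases hn : n ∈ F
  · simpa [extendZero, hn] using hx ⟨n, hn⟩
  · simpa [extendZero, hn] using hC

theorem latticeMatrix_mulVec (h : LaurentPoly d) {F : Finset (IntLattice d)} (x : F → ℤ) (i : F) :
    (latticeMatrix h F).mulVec x i = polyMul h (extendZero F x) i := by
  rw [polyMul_eq_sum (s := F) fun j _ hj => extendZero_of_notMem x hj, ← Finset.sum_coe_sort F]
  simp [Matrix.mulVec, dotProduct, latticeMatrix, extendZero_apply]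

theorem abs_latticeMatrix_mulVec_le (h : LaurentPoly d) {F : Finset (IntLattice d)} {x : F → ℤ}
    {C : ℤ} (hC : 0 ≤ C) (hx : ∀ i, |x i| ≤ C) (i : F) :
    |(latticeMatrix h F).mulVec x i| ≤ coeffNorm h * C := by
  rw [latticeMatrix_mulVec]
  exact abs_polyMul_le (abs_extendZero_le hC hx) _

/-- `D` lies so deep inside `Q` that the coefficients of `g` and `h` at sites of `D` only see
`Q`. -/
def IsInner (g h : LaurentPoly d) (Q D : Finset (IntLattice d)) : Prop :=
  D ⊆ Q ∧ ∀ i ∈ D, ∀ j, g.coeff (i - j) ≠ 0 ∨ h.coeff (i - j) ≠ 0 → j ∈ Q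

theorem IsInner.mono {g h : LaurentPoly d} {Q Q' D : Finset (IntLattice d)}
    (hD : IsInner g h Q D) (hQ : Q ⊆ Q') : IsInner g h Q' D :=
  ⟨hD.1.trans hQ, fun i hi j hj => hQ (hD.2 i hi j hj)⟩

theorem exists_isInner (g h : LaurentPoly d) (D : Finset (IntLattice d)) :
    ∃ Q, IsInner g h Q D := by
  classical
  refine ⟨D ∪ D.biUnion fun i => (g.coeff.support ∪ h.coeff.support).image fun j => i - j,
    Finset.subset_union_left, fun i hi j hj => Finset.mem_union_right _ ?_⟩
  exact Finset.mem_biUnion.2 ⟨i, hi, Finset.mem_image.2 ⟨i - j, by simpa using hj, by simp⟩⟩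

variable {f g : LaurentPoly d}

/-- Δ^g Δ^f differs from Δ^h only because Δ^f x is cut off outside `F`; rows at inner sites do not
see the cut. -/
theorem productMatrix_mulVec_of_isInner {F D : Finset (IntLattice d)}
    (hD : IsInner g (f * g) F D) (x : F → ℤ) {i : F} (hi : (i : IntLattice d) ∈ D) :
    (productMatrix f g F).mulVec x i = polyMul (f * g) (extendZero F x) i := by
  rw [productMatrix, ← Matrix.mulVec_mulVec, latticeMatrix_mulVec, mul_comm f g, polyMul_mul]
  refine polyMul_congr fun j hj => ?_
  have hjF := hD.2 i hi j (Or.inl hj)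
  exact (extendZero_apply _ ⟨j, hjF⟩).trans (latticeMatrix_mulVec f x ⟨j, hjF⟩)

theorem productMatrix_apply_of_isInner {F D : Finset (IntLattice d)}
    (hD : IsInner g (f * g) F D) {i : F} (hi : (i : IntLattice d) ∈ D) (j : F) :
    productMatrix f g F i j = (f * g).coeff ((i : IntLattice d) - j) := by
  classical
  have h1 := productMatrix_mulVec_of_isInner hD (Pi.single j 1) hi
  rw [Matrix.mulVec_single_one, Matrix.col_apply] at h1
  rw [h1, polyMul_eq_sum (s := {(j : IntLattice d)})]
  · simp [extendZero_apply]
  · intro k _ hk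
    by_cases hkF : k ∈ F
    · rw [Finset.mem_singleton] at hk
      rw [extendZero, dif_pos hkF, Pi.single_eq_of_ne]
      exact fun h => hk (congrArg Subtype.val h)
    · exact extendZero_of_notMem _ hkF

/-- Make `D` inner in a larger `F`: its rows are rows of Δ' with columns outside `D` deleted, and
the deleted entries are nonpositive. -/
theorem isTopplingMatrix_latticeMatrix
    (hΔ : ∀ F : Finset (IntLattice d), IsTopplingMatrix (productMatrix f g F))
    (D : Finset (IntLattice d)) : IsTopplingMatrix (latticeMatrix (f * g) D) := by
  classical
  obtain ⟨F, hF⟩ := exists_isInner g (f * g) D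
  have hF' := hΔ F
  refine ⟨fun i j hij => ?_, fun i => ?_⟩
  · have := hF'.1 ⟨i, hF.1 i.2⟩ ⟨j, hF.1 j.2⟩
      (fun h => hij (Subtype.ext (Subtype.mk.inj h)))
    rwa [productMatrix_apply_of_isInner hF i.2] at this
  · have h1 := hF'.2 ⟨i, hF.1 i.2⟩
    simp only [productMatrix_apply_of_isInner hF (i := ⟨i, hF.1 i.2⟩) i.2] at h1
    rw [Finset.sum_coe_sort F fun j => (f * g).coeff ((i : IntLattice d) - j),
      ← Finset.sum_sdiff hF.1] at h1
    have h2 : ∑ j ∈ F \ D, (f * g).coeff ((i : IntLattice d) - j) ≤ 0 := by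
      refine Finset.sum_nonpos fun j hj => ?_
      rw [Finset.mem_sdiff] at hj
      have := hF'.1 ⟨i, hF.1 i.2⟩ ⟨j, hj.1⟩
        (fun h => hj.2 (Subtype.mk.inj h ▸ i.2))
      rwa [productMatrix_apply_of_isInner hF i.2] at this
    have h3 : ∑ j, latticeMatrix (f * g) D i j =
        ∑ j ∈ D, (f * g).coeff ((i : IntLattice d) - j) := by
      rw [← Finset.sum_coe_sort D]
      rfl
    rw [h3]
    linarith

theorem productMatrix_diag_le (F : Finset (IntLattice d)) (i : F) :
    productMatrix f g F i i ≤ coeffNorm g * coeffNorm f := by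
  classical
  have h1 : ∀ j, |(Pi.single i 1 : F → ℤ) j| ≤ 1 := fun j => by
    rcases eq_or_ne j i with rfl | h <;> simp [*]
  have h2 := abs_latticeMatrix_mulVec_le g (mul_nonneg (coeffNorm_nonneg f) zero_le_one)
    (abs_latticeMatrix_mulVec_le f zero_le_one h1) i
  rw [Matrix.mulVec_mulVec, Matrix.mulVec_single_one, Matrix.col_apply, mul_one] at h2
  exact (le_abs_self _).trans h2

theorem coeff_zero_le : (f * g).coeff 0 ≤ coeffNorm g * coeffNorm f := by
  obtain ⟨F, hF⟩ := exists_isInner g (f * g) {0}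
  have h0 : (0 : IntLattice d) ∈ ({0} : Finset (IntLattice d)) := Finset.mem_singleton_self _
  have h := productMatrix_apply_of_isInner hF (i := ⟨0, hF.1 h0⟩) h0 ⟨0, hF.1 h0⟩
  rw [sub_self] at h
  rw [← h]
  exact productMatrix_diag_le F _

theorem nonneg_of_mem_finiteW {F : Finset (IntLattice d)} {w : F → ℤ} (hw : w ∈ finiteW f g F)
    (i : F) : 0 ≤ w i := (hw.1.1 i).1

theorem le_of_mem_finiteW {F : Finset (IntLattice d)} {w : F → ℤ} (hw : w ∈ finiteW f g F)
    (i : F) : w i ≤ coeffNorm g * coeffNorm f :=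
  (hw.1.1 i).2.le.trans (productMatrix_diag_le F i)

/-- Formally v = Δ^f Δ'⁻¹ w, where Δ'⁻¹ does not increase the sup norm by the maximum principle. The
adjugate, which is det times the inverse, keeps the argument over ℤ. The bound does not depend on
`F`. -/
theorem abs_le_of_mulVec_mem_finiteW
    (hΔ : ∀ F : Finset (IntLattice d), IsTopplingMatrix (productMatrix f g F))
    {F : Finset (IntLattice d)} {v : F → ℤ} (hv : (latticeMatrix g F).mulVec v ∈ finiteW f g F)
    (i : F) : |v i| ≤ coeffNorm f * (coeffNorm g * coeffNorm f) := by
  classical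
  set w := (latticeMatrix g F).mulVec v with hw
  set A := productMatrix f g F with hA
  have hdet := (hΔ F).det_ne_zero
  have hx : A.mulVec (A.adjugate.mulVec w) = A.det • w := by
    rw [Matrix.mulVec_mulVec, Matrix.mul_adjugate, Matrix.smul_mulVec, Matrix.one_mulVec]
  have hK : 0 ≤ |A.det| * (coeffNorm g * coeffNorm f) :=
    mul_nonneg (abs_nonneg _) (mul_nonneg (coeffNorm_nonneg _) (coeffNorm_nonneg _))
  have h1 : ∀ i, |A.adjugate.mulVec w i| ≤ |A.det| * (coeffNorm g * coeffNorm f) := by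
    refine (hΔ F).abs_le_of_abs_mulVec_le fun i => ?_
    rw [← hA, hx, Pi.smul_apply, smul_eq_mul, abs_mul, abs_of_nonneg (nonneg_of_mem_finiteW hv i)]
    exact mul_le_mul_of_nonneg_left (le_of_mem_finiteW hv i) (abs_nonneg _)
  have h2 : (latticeMatrix f F).mulVec (A.adjugate.mulVec w) = A.det • v := by
    have hg : (latticeMatrix g F).det ≠ 0 := fun h0 => by
      have : A.det = 0 := by rw [hA, productMatrix, Matrix.det_mul, h0, zero_mul]
      exact hdet this
    by_contra hne
    refine hg (Matrix.exists_mulVec_eq_zero_iff.1 ⟨_, sub_ne_zero.2 hne, ?_⟩)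
    rw [Matrix.mulVec_sub, Matrix.mulVec_smul, ← hw, ← hx, Matrix.mulVec_mulVec, hA,
      productMatrix, sub_self]
  have h3 := abs_latticeMatrix_mulVec_le f hK h1 i
  rw [h2, Pi.smul_apply, smul_eq_mul, abs_mul] at h3
  have h4 : 0 < |A.det| := abs_pos.2 hdet
  refine le_of_mul_le_mul_left (h3.trans_eq ?_) h4
  ring

/-- The maximum principle in infinite volume: integer values bounded above attain their maximum. -/
theorem le_of_polyMul_le
    (hΔ : ∀ F : Finset (IntLattice d), IsTopplingMatrix (productMatrix f g F))
    {u : Config d} {B c : ℤ} (hB : ∀ n, u n ≤ B) (hc : 0 ≤ c)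
    (h : ∀ n, polyMul (f * g) u n ≤ c) (n : IntLattice d) : u n ≤ c := by
  classical
  obtain ⟨M, ⟨k, rfl⟩, hk⟩ := Int.exists_greatest_of_bdd (P := fun z => ∃ n, u n = z)
    ⟨B, fun z ⟨n, hn⟩ => hn ▸ hB n⟩ ⟨u n, n, rfl⟩
  refine (hk (u n) ⟨n, rfl⟩).trans ?_
  by_contra! hlt
  obtain ⟨Q, hQ⟩ := exists_isInner g (f * g) {k}
  have hkk : k ∈ ({k} : Finset (IntLattice d)) := Finset.mem_singleton_self _
  have hT := isTopplingMatrix_latticeMatrix hΔ Q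
  have h2 : 0 < ∑ j ∈ Q, (f * g).coeff (k - j) := by
    rw [← Finset.sum_coe_sort Q]
    exact hT.2 ⟨k, hQ.1 hkk⟩
  have h1 : (∑ j ∈ Q, (f * g).coeff (k - j)) * u k ≤ polyMul (f * g) u k := by
    rw [polyMul_eq_sum (s := Q) fun j hj hjQ => absurd (hQ.2 k hkk j (Or.inr hj)) hjQ,
      Finset.sum_mul]
    refine Finset.sum_le_sum fun j hj => ?_
    rcases eq_or_ne k j with rfl | hkj
    · exact le_rfl
    · exact mul_le_mul_of_nonpos_left (hk (u j) ⟨j, rfl⟩)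
        (hT.1 ⟨k, hQ.1 hkk⟩ ⟨j, hj⟩ fun h => hkj (congrArg Subtype.val h))
  have h3 := h k
  nlinarith

/-- The bound for the configurations `u` with `g · u` in the subshift. -/
noncomputable def preimageBound (f g : LaurentPoly d) : ℤ :=
  coeffNorm f * (coeffNorm g * coeffNorm f)

theorem preimageBound_nonneg (f g : LaurentPoly d) : 0 ≤ preimageBound f g :=
  mul_nonneg (coeffNorm_nonneg _) (mul_nonneg (coeffNorm_nonneg _) (coeffNorm_nonneg _))

/-- h·u = f·(g·u) is bounded by constants of `f` and `g`, and the maximum principle passes the bound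
to `u`. The bound replaces the arbitrary one in `hu`, which makes compactness available. -/
theorem abs_le_of_polyMul_mem_subshiftW
    (hΔ : ∀ F : Finset (IntLattice d), IsTopplingMatrix (productMatrix f g F))
    {u : Config d} (hu : ∃ C : ℤ, ∀ n, |u n| ≤ C) (hw : polyMul g u ∈ subshiftW f g)
    (n : IntLattice d) : |u n| ≤ preimageBound f g := by
  obtain ⟨C, hC⟩ := hu
  have h1 : ∀ n, |polyMul (f * g) u n| ≤ preimageBound f g := fun n => by
    rw [polyMul_mul]
    refine abs_polyMul_le (fun j => ?_) n
    rw [abs_of_nonneg (hw.1.1 j).1]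
    exact (hw.1.1 j).2.le.trans coeff_zero_le
  refine abs_le.2 ⟨?_, le_of_polyMul_le hΔ (fun n => (abs_le.1 (hC n)).2)
    (preimageBound_nonneg f g) (fun n => (abs_le.1 (h1 n)).2) n⟩
  have h2 := le_of_polyMul_le hΔ (u := -u) (B := C)
    (fun n => by have := (abs_le.1 (hC n)).1; rw [Pi.neg_apply]; linarith)
    (preimageBound_nonneg f g)
    (fun n => by have := (abs_le.1 (h1 n)).1; rw [polyMul_neg, Pi.neg_apply]; linarith) n
  rw [Pi.neg_apply] at h2
  linarith

/-- The burning condition for a configuration on the lattice, on the subsets of `D`. -/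
def BurnsOn (h : LaurentPoly d) (D : Finset (IntLattice d)) (x : Config d) : Prop :=
  ∀ E : Finset (IntLattice d), E ⊆ D → E.Nonempty →
    ∃ i ∈ E, -(∑ j ∈ E.erase i, h.coeff (i - j)) ≤ x i

theorem BurnsOn.burns {h : LaurentPoly d} {D : Finset (IntLattice d)} {x : Config d}
    (hx : BurnsOn h D x) : Burns (latticeMatrix h D) fun i => x i := by
  classical
  intro E hE
  obtain ⟨i, hi, hle⟩ := hx (E.map (Function.Embedding.subtype _))
    (fun i hi => Finset.property_of_mem_map_subtype E hi) (hE.map)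
  obtain ⟨k, hk, rfl⟩ := Finset.mem_map.1 hi
  refine ⟨k, hk, ?_⟩
  rw [← Finset.map_erase, Finset.sum_map] at hle
  exact hle

theorem burnsOn_extendZero {F D : Finset (IntLattice d)} (hD : IsInner g (f * g) F D) {x : F → ℤ}
    (hx : Burns (productMatrix f g F) x) : BurnsOn (f * g) D (extendZero F x) := by
  classical
  intro E hED hE
  have hEF : (E.subtype (· ∈ F)).map (Function.Embedding.subtype _) = E := by
    rw [Finset.subtype_map, Finset.filter_true_of_mem fun i hi => hD.1 (hED hi)]
  obtain ⟨i, hi, hle⟩ := hx (E.subtype (· ∈ F)) (by rw [← Finset.map_nonempty, hEF]; exact hE)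
  have hiE := Finset.mem_subtype.1 hi
  refine ⟨i, hiE, ?_⟩
  rw [extendZero_apply]
  refine Eq.trans_le ?_ hle
  nth_rewrite 1 [← hEF]
  change -(∑ j ∈ (Finset.map _ (Finset.subtype (· ∈ F) E)).erase
    (Function.Embedding.subtype _ i), _) = _
  rw [← Finset.map_erase, Finset.sum_map]
  refine congrArg _ (Finset.sum_congr rfl fun j _ => ?_)
  exact (productMatrix_apply_of_isInner hD (hED hiE) j).symm

/-- Two stable and burning configurations which differ by a multiple of `h` with trivial boundary
values are equal. -/
theorem eq_on_of_burnsOn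
    (hΔ : ∀ F : Finset (IntLattice d), IsTopplingMatrix (productMatrix f g F))
    {D : Finset (IntLattice d)} {x y m : Config d} (hx : ∀ i ∈ D, x i < (f * g).coeff 0)
    (hy : ∀ i ∈ D, y i < (f * g).coeff 0) (hx' : BurnsOn (f * g) D x)
    (hy' : BurnsOn (f * g) D y)
    (hm : ∀ i ∈ D, ∀ j ∉ D, (f * g).coeff (i - j) ≠ 0 → m j = 0)
    (h : ∀ i ∈ D, x i - y i = polyMul (f * g) m i) :
    ∀ i ∈ D, m i = 0 ∧ x i = y i := by
  classical
  have h1 : ∀ i : D, (latticeMatrix (f * g) D).mulVec (fun j => m j) i =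
      polyMul (f * g) m i := fun i => by
    rw [latticeMatrix_mulVec]
    refine polyMul_congr fun j hj => ?_
    by_cases hjD : j ∈ D
    · simp [extendZero, hjD]
    · rw [extendZero_of_notMem _ hjD, hm i i.2 j hjD hj]
  have hdiag : ∀ i : D, latticeMatrix (f * g) D i i = (f * g).coeff 0 := fun i => by
    simp [latticeMatrix]
  have h2 := (isTopplingMatrix_latticeMatrix hΔ D).eq_zero_of_burns
    (v := fun i => x i) (w := fun i => y i) (n := fun i => m i)
    (fun i => by rw [hdiag]; exact hx i i.2) (fun i => by rw [hdiag]; exact hy i i.2)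
    hx'.burns hy'.burns (funext fun i => by rw [h1, ← h i i.2]; rfl)
  intro i hi
  refine ⟨congrFun h2 ⟨i, hi⟩, ?_⟩
  have h3 := h1 ⟨i, hi⟩
  rw [h2, Matrix.mulVec_zero, ← h i hi] at h3
  exact (sub_eq_zero.1 h3.symm)

theorem coeff_zero_eq_diag {F D : Finset (IntLattice d)} (hD : IsInner g (f * g) F D) {i : F}
    (hi : (i : IntLattice d) ∈ D) : productMatrix f g F i i = (f * g).coeff 0 := by
  rw [productMatrix_apply_of_isInner hD hi, sub_self]

/-- Compactness: limits of configurations which satisfy the conditions of the subshift on larger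
and larger regions. -/
theorem exists_mem_subshiftW_frequently_eq {α : Type*} {l : Filter α} [l.NeBot]
    {w v : α → Config d} {C : ℤ} (hv : ∀ a n, |v a n| ≤ C)
    (hw : ∀ n, ∀ᶠ a in l, w a n = polyMul g (v a) n ∧ 0 ≤ w a n ∧ w a n < (f * g).coeff 0)
    (hE : ∀ D, ∀ᶠ a in l, BurnsOn (f * g) D (w a)) :
    ∃ x ∈ subshiftW f g, ∀ Q : Finset (IntLattice d), ∃ᶠ a in l, ∀ n ∈ Q, x n = w a n := by
  classical
  -- Along an ultrafilter each bounded integer coordinate of `v` is eventually constant. `w` depends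
  -- locally on `v`, so it converges too; eventually along `U` yields frequently along `l`.
  let U := Ultrafilter.of l
  have hU : (U : Filter α) ≤ l := Ultrafilter.of_le l
  have hlim : ∀ n, ∃ c, ∀ᶠ a in (U : Filter α), v a n = c := by
    intro n
    have h1 : (⋃ c ∈ Set.Icc (-C) C, {a | v a n = c}) ∈ U := by
      refine Filter.mem_of_superset Filter.univ_mem fun a _ => ?_
      exact Set.mem_biUnion (abs_le.1 (hv a n)) rfl
    obtain ⟨c, -, hc⟩ := (Ultrafilter.finite_biUnion_mem_iff (Set.finite_Icc (-C) C)).1 h1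
    exact ⟨c, hc⟩
  choose u hu using hlim
  have hgu : ∀ n, ∀ᶠ a in (U : Filter α), polyMul g u n = w a n := by
    intro n
    have h1 : ∀ᶠ a in (U : Filter α), ∀ j ∈ g.coeff.support, v a (n - j) = u (n - j) :=
      (Filter.eventually_all_finset _).2 fun j _ => hu _
    filter_upwards [h1, hU (hw n)] with a ha ha'
    rw [ha'.1]
    exact Finset.sum_congr rfl fun j hj => by rw [ha j hj]
  have hgu' : ∀ Q : Finset (IntLattice d), ∀ᶠ a in (U : Filter α),
      ∀ n ∈ Q, polyMul g u n = w a n :=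
    fun Q => (Filter.eventually_all_finset _).2 fun n _ => hgu n
  refine ⟨polyMul g u, ⟨⟨fun i => ?_, fun E hne => ?_⟩, u, ⟨C, fun n => ?_⟩, rfl⟩, fun Q => ?_⟩
  · obtain ⟨a, ha, ha'⟩ := ((hgu i).and (hU (hw i))).exists
    rw [ha]
    exact ha'.2
  · obtain ⟨a, ha, ha'⟩ := ((hgu' E).and (hU (hE E))).exists
    obtain ⟨i, hi, hle⟩ := ha' E le_rfl hne
    exact ⟨i, hi, by rw [ha i hi]; exact hle⟩
  · obtain ⟨a, ha⟩ := (hu n).exists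
    rw [← ha]
    exact hv a n
  · exact (hgu' Q).frequently.filter_mono hU

theorem burnsOn_of_mem_subshiftW {x : Config d} (hx : x ∈ subshiftW f g)
    (D : Finset (IntLattice d)) : BurnsOn (f * g) D x := fun E _ hE => hx.1.2 E hE

/-- The subshift is closed, because the bounded preimages can be taken with one common bound. -/
theorem mem_subshiftW_of_forall_finset
    (hΔ : ∀ F : Finset (IntLattice d), IsTopplingMatrix (productMatrix f g F)) {x : Config d}
    (hx : ∀ Q : Finset (IntLattice d), ∃ w ∈ subshiftW f g, ∀ n ∈ Q, w n = x n) :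
    x ∈ subshiftW f g := by
  choose w hw hwx using hx
  have hw2 := fun Q => (hw Q).2
  choose u hu hwu using hw2
  obtain ⟨y, hy, hyx⟩ := exists_mem_subshiftW_frequently_eq (f := f) (g := g) (l := atTop)
    (w := w) (v := u) (C := preimageBound f g)
    (fun Q => abs_le_of_polyMul_mem_subshiftW hΔ (hu Q) (hwu Q ▸ hw Q))
    (fun n => Eventually.of_forall fun Q => ⟨by rw [← hwu Q], (hw Q).1.1 n⟩)
    (fun D => Eventually.of_forall fun Q => burnsOn_of_mem_subshiftW (hw Q) D)
  convert hy
  ext n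
  obtain ⟨Q, hQ, hQn⟩ := ((hyx {n}).and_eventually (eventually_ge_atTop {n})).exists
  rw [hQ n (Finset.mem_singleton_self n), hwx Q n (hQn (Finset.mem_singleton_self n))]

/-- Otherwise counterexamples on ever larger `F` would have a limit point in the subshift agreeing
with one of them on `Q`. -/
theorem exists_forall_finiteW_exists_subshiftW
    (hΔ : ∀ F : Finset (IntLattice d), IsTopplingMatrix (productMatrix f g F))
    (Q : Finset (IntLattice d)) : ∃ F₀, ∀ F, F₀ ⊆ F → ∀ w ∈ finiteW f g F,
      ∃ x ∈ subshiftW f g, ∀ n ∈ Q, x n = extendZero F w n := by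
  classical
  by_contra! hcon
  choose F hF w hw hbad using hcon
  have hw2 := fun F₀ => (hw F₀).2
  choose v hv using hw2
  have hinner : ∀ D, ∀ᶠ F₀ in atTop, IsInner g (f * g) (F F₀) D := fun D => by
    obtain ⟨Q', hQ'⟩ := exists_isInner g (f * g) D
    exact (eventually_ge_atTop Q').mono fun F₀ h => hQ'.mono (h.trans (hF F₀))
  obtain ⟨x, hx, hxw⟩ := exists_mem_subshiftW_frequently_eq (f := f) (g := g) (l := atTop)
    (w := fun F₀ => extendZero (F F₀) (w F₀)) (v := fun F₀ => extendZero (F F₀) (v F₀))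
    (C := preimageBound f g)
    (fun F₀ => abs_extendZero_le (preimageBound_nonneg f g)
      (abs_le_of_mulVec_mem_finiteW hΔ (hv F₀ ▸ hw F₀)))
    (fun n => (hinner {n}).mono fun F₀ h => by
      have hn := Finset.mem_singleton_self n
      have h1 := extendZero_apply (w F₀) ⟨n, h.1 hn⟩
      simp only at h1
      rw [h1]
      refine ⟨?_, (hw F₀).1.1 _ |>.1, ?_⟩
      · rw [hv F₀]
        exact latticeMatrix_mulVec g (v F₀) ⟨n, h.1 hn⟩
      · rw [← coeff_zero_eq_diag h (i := ⟨n, h.1 hn⟩) hn]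
        exact ((hw F₀).1.1 _).2)
    (fun D => (hinner D).mono fun F₀ h =>
      burnsOn_extendZero h ((hΔ _).burns_of_mem_recurrentSet (hw F₀).1))
  obtain ⟨F₀, h⟩ := (hxw Q).exists
  obtain ⟨n, hn, hne⟩ := hbad F₀ x hx
  exact hne (h n hn)

end Lattice

/-! ### Counting patterns and elements of W_F up to boundary factors. -/

section Counting

variable {d : ℕ} {f g : LaurentPoly d}

/-- Since Δ' = Δ^g Δ^f, the whole class of a multiple of Δ^g consists of multiples of Δ^g, including
its recurrent representative. -/
theorem exists_mem_finiteW
    (hΔ : ∀ F : Finset (IntLattice d), IsTopplingMatrix (productMatrix f g F))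
    {F : Finset (IntLattice d)} (y : F → ℤ) :
    ∃ w ∈ finiteW f g F, ∃ n,
      w = (latticeMatrix g F).mulVec y - (productMatrix f g F).mulVec n := by
  obtain ⟨w, hw, n, hn⟩ := (hΔ F).exists_recurrent ((latticeMatrix g F).mulVec y)
  refine ⟨w, ⟨hw, y - (latticeMatrix f F).mulVec n, ?_⟩, n, hn⟩
  rw [hn, productMatrix, ← Matrix.mulVec_mulVec, Matrix.mulVec_sub]

theorem finiteW_nonempty
    (hΔ : ∀ F : Finset (IntLattice d), IsTopplingMatrix (productMatrix f g F))
    (F : Finset (IntLattice d)) : (finiteW f g F).Nonempty := by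
  obtain ⟨w, hw, -⟩ := exists_mem_finiteW hΔ (0 : F → ℤ)
  exact ⟨w, hw⟩

theorem finiteW_finite (F : Finset (IntLattice d)) : (finiteW f g F).Finite :=
  (finite_setOf_isStable (productMatrix f g F)).subset fun _ hw => hw.1.1

theorem exists_sandAdd_eq
    (hΔ : ∀ F : Finset (IntLattice d), IsTopplingMatrix (productMatrix f g F))
    {F : Finset (IntLattice d)} :
    ∀ x ∈ finiteW f g F, ∀ y ∈ finiteW f g F, ∃ w ∈ finiteW f g F,
      sandAdd (productMatrix f g F) x w = y := by
  rintro x ⟨hx, a, hxa⟩ y ⟨hy, b, hyb⟩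
  obtain ⟨w, hw, n, hn⟩ := exists_mem_finiteW hΔ (b - a)
  refine ⟨w, hw, (hΔ F).sandAdd_eq (n := -n) hx hw.1.1 hy ?_⟩
  rw [hn, hxa, hyb, Matrix.mulVec_sub, Matrix.mulVec_neg]
  abel

theorem finiteW_eq_of_sub_eq
    (hΔ : ∀ F : Finset (IntLattice d), IsTopplingMatrix (productMatrix f g F))
    {F : Finset (IntLattice d)} {v w n : F → ℤ} (hv : v ∈ finiteW f g F)
    (hw : w ∈ finiteW f g F) (h : v - w = (productMatrix f g F).mulVec n) : v = w := by
  classical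
  exact (hΔ F).eq_of_burns hv.1.1 hw.1.1 ((hΔ F).burns_of_mem_recurrentSet hv.1)
    ((hΔ F).burns_of_mem_recurrentSet hw.1) h

/-- The restrictions to `Q` of the elements of `Y`. -/
def patterns (Y : Set (Config d)) (Q : Finset (IntLattice d)) : Set (Q → ℤ) :=
  (fun (v : Config d) (j : Q) => v j) '' Y

theorem patterns_subshiftW_finite (f g : LaurentPoly d) (Q : Finset (IntLattice d)) :
    (patterns (subshiftW f g) Q).Finite := by
  refine (Set.Finite.pi' fun _ : Q => Set.finite_Ico 0 ((f * g).coeff 0)).subset ?_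
  rintro _ ⟨v, hv, rfl⟩ j
  exact ⟨(hv.1.1 j).1, (hv.1.1 j).2⟩

/-- Bound for the toppling numbers between configurations in the counting arguments. -/
noncomputable def topplingBound (f g : LaurentPoly d) : ℤ :=
  coeffNorm g * coeffNorm f + coeffNorm g * preimageBound f g

/-- The possible values at one site of a toppling number and a configuration. -/
noncomputable def siteCodes (f g : LaurentPoly d) : Finset (ℤ × ℤ) :=
  Finset.Icc (-topplingBound f g) (topplingBound f g) ×ˢ
    Finset.Icc 0 (coeffNorm g * coeffNorm f)

/-- The possible values of toppling numbers and configurations on `E`. -/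
noncomputable def boundaryCodes (f g : LaurentPoly d) (E : Finset (IntLattice d)) :
    Finset (E → ℤ × ℤ) := Fintype.piFinset fun _ => siteCodes f g

theorem card_boundaryCodes (f g : LaurentPoly d) (E : Finset (IntLattice d)) :
    (boundaryCodes f g E).card = (siteCodes f g).card ^ E.card := by
  rw [boundaryCodes, Fintype.card_piFinset, Finset.prod_const, Finset.card_univ, Fintype.card_coe]

theorem mem_siteCodes {a b : ℤ} (ha : |a| ≤ topplingBound f g) (hb : 0 ≤ b)
    (hb' : b ≤ coeffNorm g * coeffNorm f) : (a, b) ∈ siteCodes f g :=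
  Finset.mem_product.2 ⟨Finset.mem_Icc.2 (abs_le.1 ha), Finset.mem_Icc.2 ⟨hb, hb'⟩⟩

/-- Δ' m = w + Δ^g y - z is bounded uniformly in `F`, and the maximum principle passes this to `m`.
-/
theorem abs_toppling_le
    (hΔ : ∀ F : Finset (IntLattice d), IsTopplingMatrix (productMatrix f g F))
    {F : Finset (IntLattice d)} {w z y m : F → ℤ}
    (hw : ∀ i, 0 ≤ w i) (hw' : ∀ i, w i ≤ coeffNorm g * coeffNorm f) (hz : z ∈ finiteW f g F)
    (hy : ∀ i, |y i| ≤ preimageBound f g)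
    (h : z = w + (latticeMatrix g F).mulVec y - (productMatrix f g F).mulVec m) (i : F) :
    |m i| ≤ topplingBound f g := by
  refine (hΔ F).abs_le_of_abs_mulVec_le (fun i => ?_) i
  have h1 := congrFun h i
  simp only [Pi.sub_apply, Pi.add_apply] at h1
  have h2 := abs_le.1 (abs_latticeMatrix_mulVec_le g (preimageBound_nonneg f g) hy i)
  rw [topplingBound]
  have h3 := nonneg_of_mem_finiteW hz i
  have h4 := le_of_mem_finiteW hz i
  have h5 := hw i
  have h6 := hw' i
  exact abs_le.2 ⟨by linarith, by linarith⟩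

theorem latticeMatrix_mulVec_eq_of_isInner {h : LaurentPoly d} {F Q D : Finset (IntLattice d)}
    (hD : IsInner g h Q D) {U : F → ℤ} {u : Config d}
    (hU : ∀ j ∈ Q, extendZero F U j = u j) {i : F} (hi : (i : IntLattice d) ∈ D) :
    (latticeMatrix g F).mulVec U i = polyMul g u i := by
  rw [latticeMatrix_mulVec]
  exact polyMul_congr fun j hj => hU j (hD.2 i hi j (Or.inl hj))

/-- Every pattern on `Q` has about the same number of extensions to elements of `W_F`. -/
theorem ncard_extensions_mul_le
    (hΔ : ∀ F : Finset (IntLattice d), IsTopplingMatrix (productMatrix f g F))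
    {F Q D : Finset (IntLattice d)} (hQF : Q ⊆ F) (hD : IsInner g (f * g) Q D) (a : Q → ℤ) :
    ({w : F → ℤ | ∀ j : Q, extendZero F w j = a j} ∩ finiteW f g F).ncard *
        (patterns (subshiftW f g) Q).ncard ≤
      (finiteW f g F).ncard * (siteCodes f g).card ^ (Q \ D).card := by
  classical
  have hpat : ∀ b ∈ patterns (subshiftW f g) Q, ∃ u : Config d, polyMul g u ∈ subshiftW f g ∧
      (∀ n, |u n| ≤ preimageBound f g) ∧ ∀ j : Q, polyMul g u j = b j := by
    rintro _ ⟨w, hw, rfl⟩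
    obtain ⟨u, hu, hwu⟩ := hw.2
    subst hwu
    exact ⟨u, hw, abs_le_of_polyMul_mem_subshiftW hΔ hu hw, fun _ => rfl⟩
  choose! u huW hub hu using hpat
  let U : (Q → ℤ) → F → ℤ := fun b i => if (i : IntLattice d) ∈ Q then u b i else 0
  have hUu : ∀ b, ∀ j ∈ Q, extendZero F (U b) j = u b j := fun b j hj => by
    simp [extendZero, U, hj, hQF hj]
  have hUb : ∀ b ∈ patterns (subshiftW f g) Q, ∀ i, |U b i| ≤ preimageBound f g := by
    intro b hb i
    simp only [U]
    split_ifs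
    · exact hub b hb i
    · rw [abs_zero]; exact preimageBound_nonneg f g
  have hrep : ∀ p : (F → ℤ) × (Q → ℤ), p.1 ∈ finiteW f g F → ∃ z m : F → ℤ,
      z ∈ finiteW f g F ∧
        z = p.1 + (latticeMatrix g F).mulVec (U p.2) - (productMatrix f g F).mulVec m := by
    rintro p ⟨-, v, hv⟩
    obtain ⟨z, hz, m, hm⟩ := exists_mem_finiteW hΔ (v + U p.2)
    exact ⟨z, m, hz, by rw [hm, hv, Matrix.mulVec_add]⟩
  choose! z m hz hzm using hrep
  rw [← card_boundaryCodes, ← Set.ncard_coe_finset, ← Set.ncard_prod, ← Set.ncard_prod]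
  -- The pair (w, b) is encoded by `z` and, on `Q \ D` only, by the toppling numbers and `b`.
  refine Set.ncard_le_ncard_of_injOn
    (fun p => (z p, fun i : ↥(Q \ D) => (extendZero F (m p) i,
      if h : (i : IntLattice d) ∈ Q then p.2 ⟨i, h⟩ else 0))) ?_ ?_
    ((finiteW_finite F).prod (Finset.finite_toSet _))
  · rintro p ⟨⟨-, hpW⟩, hpb⟩
    refine ⟨hz p hpW, ?_⟩
    rw [Finset.mem_coe, boundaryCodes, Fintype.mem_piFinset]
    intro i
    have hiQ := (Finset.mem_sdiff.1 i.2).1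
    simp only [dif_pos hiQ]
    obtain ⟨x, hx, hxp⟩ := hpb
    have hxi : p.2 ⟨i, hiQ⟩ = x i := by rw [← hxp]
    rw [hxi]
    refine mem_siteCodes ?_ (hx.1.1 i).1 ((hx.1.1 i).2.le.trans coeff_zero_le)
    have h1 := abs_toppling_le hΔ (nonneg_of_mem_finiteW hpW) (le_of_mem_finiteW hpW) (hz p hpW)
      (hUb p.2 ⟨x, hx, hxp⟩) (hzm p hpW) ⟨i, hQF hiQ⟩
    rwa [← extendZero_apply (m p)] at h1
  · rintro p ⟨⟨hpa, hpW⟩, hpb⟩ q ⟨⟨hqa, hqW⟩, hqb⟩ hpq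
    obtain ⟨hzz, hcode⟩ := Prod.mk.inj hpq
    have hcode' : ∀ i (hi : i ∈ Q), i ∉ D →
        extendZero F (m p) i = extendZero F (m q) i ∧ p.2 ⟨i, hi⟩ = q.2 ⟨i, hi⟩ := by
      intro i hi hiD
      have h1 := congrFun hcode ⟨i, Finset.mem_sdiff.2 ⟨hi, hiD⟩⟩
      simp only [hi, dif_pos] at h1
      exact Prod.mk.inj h1
    have hdiff : (productMatrix f g F).mulVec (m p - m q) = p.1 - q.1 +
        ((latticeMatrix g F).mulVec (U p.2) - (latticeMatrix g F).mulVec (U q.2)) := by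
      have h1 := hzm p hpW
      have h2 := hzm q hqW
      rw [hzz, h2] at h1
      rw [Matrix.mulVec_sub]
      linear_combination h1
    have hDF := hD.mono hQF
    -- Equal codes: the toppling difference vanishes on `Q \ D`, and on `D` the parts `p.1` and
    -- `q.1` both equal `a`, so the two subshift patterns differ there by h times that difference.
    have hxy := eq_on_of_burnsOn hΔ (D := D) (x := polyMul g (u p.2)) (y := polyMul g (u q.2))
      (m := extendZero F (m p - m q)) (fun i _ => ((huW p.2 hpb).1.1 i).2)
      (fun i _ => ((huW q.2 hqb).1.1 i).2) (burnsOn_of_mem_subshiftW (huW p.2 hpb) D)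
      (burnsOn_of_mem_subshiftW (huW q.2 hqb) D)
      (fun i hi j hjD hj => by
        have hjQ := hD.2 i hi j (Or.inr hj)
        have h1 := (hcode' j hjQ hjD).1
        simp only [extendZero, hQF hjQ, dif_pos] at h1
        simp [extendZero, hQF hjQ, h1])
      (fun i hi => by
        have h1 := congrFun hdiff ⟨i, hDF.1 hi⟩
        rw [productMatrix_mulVec_of_isInner hDF _ (i := ⟨i, hDF.1 hi⟩) hi] at h1
        simp only [Pi.add_apply, Pi.sub_apply] at h1
        rw [latticeMatrix_mulVec_eq_of_isInner hD (hUu p.2) (i := ⟨i, hDF.1 hi⟩) hi,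
          latticeMatrix_mulVec_eq_of_isInner hD (hUu q.2) (i := ⟨i, hDF.1 hi⟩) hi,
          ← extendZero_apply p.1, ← extendZero_apply q.1] at h1
        have h2 := hpa ⟨i, hD.1 hi⟩
        have h3 := hqa ⟨i, hD.1 hi⟩
        simp only at h1 h2 h3
        rw [h1, h2, h3, sub_self, zero_add])
    have hb : p.2 = q.2 := by
      funext i
      by_cases hiD : (i : IntLattice d) ∈ D
      · rw [← hu p.2 hpb i, ← hu q.2 hqb i, (hxy i hiD).2]
      · exact (hcode' i i.2 hiD).2
    rw [hb, sub_self, add_zero] at hdiff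
    exact Prod.ext (finiteW_eq_of_sub_eq hΔ hpW hqW hdiff.symm) hb

/-- The case `F = Q`, with an element of W_Q as the pattern `a`, so that `a` has an extension. -/
theorem ncard_patterns_le
    (hΔ : ∀ F : Finset (IntLattice d), IsTopplingMatrix (productMatrix f g F))
    {Q D : Finset (IntLattice d)} (hD : IsInner g (f * g) Q D) :
    (patterns (subshiftW f g) Q).ncard ≤
      (finiteW f g Q).ncard * (siteCodes f g).card ^ (Q \ D).card := by
  obtain ⟨w, hw⟩ := finiteW_nonempty hΔ Q
  refine le_trans ?_ (ncard_extensions_mul_le hΔ subset_rfl hD w)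
  refine Nat.le_mul_of_pos_left _ ((Set.ncard_pos ((finiteW_finite Q).inter_of_right _)).2 ?_)
  exact ⟨w, fun j => extendZero_apply w j, hw⟩

/-- Reverse surgery: for w = Δ^g v on `Q`, extend `v` by zero to a large `F` and take the recurrent
representative `z`. On `Q` it is a subshift pattern, and together with boundary data it determines
`w` by burning uniqueness on `D`. -/
theorem ncard_finiteW_le
    (hΔ : ∀ F : Finset (IntLattice d), IsTopplingMatrix (productMatrix f g F))
    {Q D : Finset (IntLattice d)} (hD : IsInner g (f * g) Q D) :
    (finiteW f g Q).ncard ≤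
      (patterns (subshiftW f g) Q).ncard * (siteCodes f g).card ^ (Q \ D).card := by
  classical
  obtain ⟨F₀, hF₀⟩ := exists_forall_finiteW_exists_subshiftW hΔ Q
  set F := F₀ ∪ Q with hF
  have hQF : Q ⊆ F := Finset.subset_union_right
  have hpat := hF₀ F Finset.subset_union_left
  have hrep : ∀ w : Q → ℤ, w ∈ finiteW f g Q → ∃ (v : Q → ℤ) (z m : F → ℤ),
      w = (latticeMatrix g Q).mulVec v ∧ z ∈ finiteW f g F ∧
        z = (latticeMatrix g F).mulVec (fun i => extendZero Q v i) -
          (productMatrix f g F).mulVec m := by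
    rintro w ⟨-, v, hv⟩
    obtain ⟨z, hz, m, hm⟩ := exists_mem_finiteW hΔ (F := F) (fun i => extendZero Q v i)
    exact ⟨v, z, m, hv, hz, hm⟩
  choose! v z m hv hz hzm using hrep
  have hVv : ∀ w, ∀ j ∈ Q, extendZero F (fun i => extendZero Q (v w) i) j =
      extendZero Q (v w) j := fun w j hj => extendZero_apply (F := F) _ ⟨j, hQF hj⟩
  rw [← card_boundaryCodes, ← Set.ncard_coe_finset, ← Set.ncard_prod]
  refine Set.ncard_le_ncard_of_injOn
    (fun w => (fun i : Q => extendZero F (z w) i, fun i : ↥(Q \ D) => (extendZero F (m w) i,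
      extendZero Q w i))) ?_ ?_
    ((patterns_subshiftW_finite f g Q).prod (Finset.finite_toSet _))
  · intro w hw
    refine ⟨?_, ?_⟩
    · obtain ⟨x, hx, hxz⟩ := hpat (z w) (hz w hw)
      exact ⟨x, hx, funext fun i => hxz i i.2⟩
    rw [Finset.mem_coe, boundaryCodes, Fintype.mem_piFinset]
    intro i
    have hiQ := (Finset.mem_sdiff.1 i.2).1
    have hwi := extendZero_apply w ⟨i, hiQ⟩
    simp only at hwi ⊢
    rw [hwi]
    refine mem_siteCodes ?_ (nonneg_of_mem_finiteW hw _) (le_of_mem_finiteW hw _)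
    have h1 := abs_toppling_le hΔ (w := 0) (y := fun i : F => extendZero Q (v w) i) (m := m w)
      (fun _ => le_rfl)
      (fun _ => mul_nonneg (coeffNorm_nonneg _) (coeffNorm_nonneg _)) (hz w hw)
      (fun i => abs_extendZero_le (preimageBound_nonneg f g)
        (abs_le_of_mulVec_mem_finiteW hΔ (hv w hw ▸ hw)) i)
      (by rw [zero_add]; exact hzm w hw) ⟨i, hQF hiQ⟩
    rwa [← extendZero_apply (m w)] at h1
  · intro p hp q hq hpq
    obtain ⟨hzz, hcode⟩ := Prod.mk.inj hpq
    have hcode' : ∀ i ∈ Q, i ∉ D → extendZero F (m p) i = extendZero F (m q) i ∧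
        extendZero Q p i = extendZero Q q i := by
      intro i hi hiD
      exact Prod.mk.inj (congrFun hcode ⟨i, Finset.mem_sdiff.2 ⟨hi, hiD⟩⟩)
    have hDF := hD.mono hQF
    have hval : ∀ w ∈ finiteW f g Q, ∀ (i) (hi : i ∈ D), extendZero Q w i =
        extendZero F (z w) i + (productMatrix f g F).mulVec (m w) ⟨i, hDF.1 hi⟩ := by
      intro w hw i hi
      have h1 := congrFun (hzm w hw) ⟨i, hDF.1 hi⟩
      rw [Pi.sub_apply, latticeMatrix_mulVec_eq_of_isInner hD (hVv w) (i := ⟨i, hDF.1 hi⟩) hi,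
        ← latticeMatrix_mulVec g (v w) ⟨i, hD.1 hi⟩, ← hv w hw, ← extendZero_apply w,
        ← extendZero_apply (z w)] at h1
      simp only at h1
      linarith
    have hstab : ∀ w ∈ finiteW f g Q, ∀ i ∈ D, extendZero Q w i < (f * g).coeff 0 := by
      intro w hw i hi
      have h1 := (hw.1.1 ⟨i, hD.1 hi⟩).2
      rwa [coeff_zero_eq_diag hD hi, ← extendZero_apply w] at h1
    have hxy := eq_on_of_burnsOn hΔ (D := D) (x := extendZero Q p) (y := extendZero Q q)
      (m := extendZero F (m p - m q)) (hstab p hp) (hstab q hq)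
      (burnsOn_extendZero hD ((hΔ Q).burns_of_mem_recurrentSet hp.1))
      (burnsOn_extendZero hD ((hΔ Q).burns_of_mem_recurrentSet hq.1))
      (fun i hi j hjD hj => by
        have hjQ := hD.2 i hi j (Or.inr hj)
        have h1 := (hcode' j hjQ hjD).1
        simp only [extendZero, hQF hjQ, dif_pos] at h1
        simp [extendZero, hQF hjQ, h1])
      (fun i hi => by
        rw [hval p hp i hi, hval q hq i hi, congrFun hzz ⟨i, hD.1 hi⟩,
          ← productMatrix_mulVec_of_isInner hDF _ (i := ⟨i, hDF.1 hi⟩) hi, Matrix.mulVec_sub,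
          Pi.sub_apply]
        ring)
    funext i
    rw [← extendZero_apply p, ← extendZero_apply q]
    by_cases hiD : (i : IntLattice d) ∈ D
    · exact (hxy i hiD).2
    · exact (hcode' i i.2 hiD).2

end Counting

/-! ### Gibbs' inequality and elementary entropy bounds. -/

section Gibbs

variable {α : Type*}

/-- Gibbs' inequality. -/
theorem sum_negMulLog_le {s : Finset α} {p q : α → ℝ} (hp : ∀ a ∈ s, 0 ≤ p a)
    (hq : ∀ a ∈ s, 0 < q a) (hqp : ∑ a ∈ s, q a ≤ ∑ a ∈ s, p a) :
    ∑ a ∈ s, Real.negMulLog (p a) ≤ ∑ a ∈ s, p a * -Real.log (q a) := by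
  have h : ∀ a ∈ s, Real.negMulLog (p a) ≤ p a * -Real.log (q a) + (q a - p a) := by
    intro a ha
    rcases (hp a ha).eq_or_lt with h0 | h0
    · rw [← h0]
      simpa using (hq a ha).le
    · have h1 := Real.log_le_sub_one_of_pos (div_pos (hq a ha) h0)
      rw [Real.log_div (hq a ha).ne' h0.ne'] at h1
      have h2 := mul_le_mul_of_nonneg_left h1 h0.le
      rw [mul_sub, mul_sub, mul_div_cancel₀ _ h0.ne'] at h2
      rw [Real.negMulLog]
      linarith
  refine (Finset.sum_le_sum h).trans ?_
  rw [Finset.sum_add_distrib, Finset.sum_sub_distrib]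
  linarith

theorem sum_negMulLog_le_log_card {s : Finset α} {p : α → ℝ} (hp : ∀ a ∈ s, 0 ≤ p a)
    (h1 : ∑ a ∈ s, p a = 1) : ∑ a ∈ s, Real.negMulLog (p a) ≤ Real.log s.card := by
  have hs : s.Nonempty := by
    rw [Finset.nonempty_iff_ne_empty]
    rintro rfl
    simp at h1
  have hc : (0 : ℝ) < s.card := by exact_mod_cast hs.card_pos
  refine (sum_negMulLog_le (q := fun _ => (s.card : ℝ)⁻¹) hp (fun _ _ => inv_pos.2 hc) ?_).trans ?_
  · rw [h1, Finset.sum_const, nsmul_eq_mul, mul_inv_cancel₀ hc.ne']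
  · rw [← Finset.sum_mul, h1, Real.log_inv, neg_neg, one_mul]

theorem le_sum_negMulLog {s : Finset α} {p : α → ℝ} {c : ℝ} (hp : ∀ a ∈ s, 0 ≤ p a)
    (h1 : ∑ a ∈ s, p a = 1) (hc : ∀ a ∈ s, p a ≤ c) :
    -Real.log c ≤ ∑ a ∈ s, Real.negMulLog (p a) := by
  have h : ∀ a ∈ s, p a * -Real.log c ≤ Real.negMulLog (p a) := by
    intro a ha
    rcases (hp a ha).eq_or_lt with h0 | h0
    · simp [← h0]
    · rw [Real.negMulLog, neg_mul, mul_neg]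
      exact neg_le_neg (mul_le_mul_of_nonneg_left (Real.log_le_log h0 (hc a ha)) h0.le)
  refine le_trans ?_ (Finset.sum_le_sum h)
  rw [← Finset.sum_mul, h1, one_mul]

end Gibbs

/-! ### The limit measure: its support and lower entropy bound. -/

section Limit

variable {d : ℕ} {f g : LaurentPoly d}

/-- The configurations with the pattern `a` on `Q`. -/
def patternCylinder (Q : Finset (IntLattice d)) (a : Q → ℤ) : Set (Config d) :=
  {v | ∀ j : Q, v j = a j}

theorem isClopen_patternCylinder (Q : Finset (IntLattice d)) (a : Q → ℤ) :
    IsClopen (patternCylinder Q a) := by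
  rw [patternCylinder, Set.ofPred_forall]
  exact isClopen_iInter_of_finite fun j =>
    (isClopen_discrete {a j}).preimage (continuous_apply (j : IntLattice d))

theorem measurableSet_patternCylinder (Q : Finset (IntLattice d)) (a : Q → ℤ) :
    MeasurableSet (patternCylinder Q a) :=
  (isClopen_patternCylinder Q a).isOpen.measurableSet

theorem measureReal_eq_zero_of_forall_notMem {Ω : Type*} [MeasurableSpace Ω] {μ : Measure Ω}
    {Y S : Set Ω} (hY : μ Yᶜ = 0) (h : ∀ v ∈ S, v ∉ Y) : μ.real S = 0 := by
  rw [measureReal_def, measure_mono_null h hY, ENNReal.toReal_zero]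

/-- The mass of a clopen set is continuous for weak convergence, so eventual bounds survive at
cluster points. -/
theorem MapClusterPt.measureReal_le {κ : Type*} {l : Filter κ} {m : κ → ProbabilityMeasure (Config d)}
    {μ : ProbabilityMeasure (Config d)} (hμ : MapClusterPt μ l m) {C : Set (Config d)}
    (hC : IsClopen C) {K : ℝ} (hK : ∀ᶠ k in l, (m k : Measure (Config d)).real C ≤ K) :
    (μ : Measure (Config d)).real C ≤ K := by
  by_contra! hlt
  have h1 : Tendsto (fun ν : ProbabilityMeasure (Config d) => ((ν C : NNReal) : ℝ)) (𝓝 μ)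
      (𝓝 ((μ C : NNReal) : ℝ)) :=
    NNReal.tendsto_coe.2
      (ProbabilityMeasure.tendsto_measure_of_isClopen_of_tendsto tendsto_id hC)
  have h2 := h1.eventually (lt_mem_nhds (a := K) hlt)
  obtain ⟨k, hk, hk'⟩ := ((hμ.frequently h2).and_eventually hK).exists
  exact absurd hk' (not_le.2 hk)

theorem extendMeasure_real_patternCylinder {F : Finset (IntLattice d)}
    (m : ProbabilityMeasure (F → ℤ)) (Q : Finset (IntLattice d)) (a : Q → ℤ) :
    (extendMeasure F m : Measure (Config d)).real (patternCylinder Q a) =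
      (m : Measure (F → ℤ)).real {w | ∀ j : Q, extendZero F w j = a j} := by
  rw [extendMeasure, ProbabilityMeasure.toMeasure_map,
    map_measureReal_apply (measurable_extendZero F) (measurableSet_patternCylinder Q a)]
  rfl

theorem IsSandpileHaar.real_patternCylinder_mul_le
    (hΔ : ∀ F : Finset (IntLattice d), IsTopplingMatrix (productMatrix f g F))
    {F Q D : Finset (IntLattice d)} (hQF : Q ⊆ F) (hD : IsInner g (f * g) Q D)
    {m : ProbabilityMeasure (F → ℤ)}
    (hm : IsSandpileHaar (productMatrix f g F) (finiteW f g F) m) (a : Q → ℤ) :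
    (extendMeasure F m : Measure (Config d)).real (patternCylinder Q a) *
      (patterns (subshiftW f g) Q).ncard ≤ (siteCodes f g).card ^ (Q \ D).card := by
  have h1 : (0 : ℝ) < (finiteW f g F).ncard := by
    exact_mod_cast (Set.ncard_pos (finiteW_finite F)).2 (finiteW_nonempty hΔ F)
  refine le_of_mul_le_mul_right ?_ h1
  rw [extendMeasure_real_patternCylinder, mul_right_comm,
    hm.real_mul_ncard (finiteW_finite F) (exists_sandAdd_eq hΔ), mul_comm _ ((finiteW f g F).ncard : ℝ)]
  exact_mod_cast ncard_extensions_mul_le hΔ hQF hD a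

variable {F : ℕ → Finset (IntLattice d)} {ν : ∀ k, ProbabilityMeasure (F k → ℤ)}
  {μ : ProbabilityMeasure (Config d)}

theorem limit_real_patternCylinder_mul_le
    (hΔ : ∀ F : Finset (IntLattice d), IsTopplingMatrix (productMatrix f g F))
    (hF : Tendsto F atTop atTop)
    (hν : ∀ k, IsSandpileHaar (productMatrix f g (F k)) (finiteW f g (F k)) (ν k))
    (hμ : MapClusterPt μ atTop (fun k => extendMeasure (F k) (ν k)))
    {Q D : Finset (IntLattice d)} (hD : IsInner g (f * g) Q D)
    (hpos : 0 < (patterns (subshiftW f g) Q).ncard) (a : Q → ℤ) :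
    (μ : Measure (Config d)).real (patternCylinder Q a) ≤
      (siteCodes f g).card ^ (Q \ D).card / (patterns (subshiftW f g) Q).ncard := by
  have hpos' : (0 : ℝ) < (patterns (subshiftW f g) Q).ncard := by exact_mod_cast hpos
  refine hμ.measureReal_le (isClopen_patternCylinder Q a) ?_
  filter_upwards [hF.eventually_ge_atTop Q] with k hk
  rw [le_div_iff₀ hpos']
  exact (hν k).real_patternCylinder_mul_le hΔ hk hD a

/-- By closedness the complement is a countable union of cylinders over patterns foreign to the
subshift, and each of these is null for all large `F k`. -/
theorem limit_subshiftW_compl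
    (hΔ : ∀ F : Finset (IntLattice d), IsTopplingMatrix (productMatrix f g F))
    (hF : Tendsto F atTop atTop)
    (hν : ∀ k, IsSandpileHaar (productMatrix f g (F k)) (finiteW f g (F k)) (ν k))
    (hμ : MapClusterPt μ atTop (fun k => extendMeasure (F k) (ν k))) :
    (μ : Measure (Config d)) (subshiftW f g)ᶜ = 0 := by
  have hsub : (subshiftW f g)ᶜ ⊆ ⋃ Q : Finset (IntLattice d),
      ⋃ a : {a : Q → ℤ // a ∉ patterns (subshiftW f g) Q}, patternCylinder Q a := by
    intro x hx
    by_contra hcon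
    refine hx (mem_subshiftW_of_forall_finset hΔ fun Q => ?_)
    by_contra hQ
    refine hcon (Set.mem_iUnion.2 ⟨Q, Set.mem_iUnion.2 ⟨⟨fun j => x j, ?_⟩, fun j => rfl⟩⟩)
    rintro ⟨w, hw, hwx⟩
    exact hQ ⟨w, hw, fun n hn => congrFun hwx ⟨n, hn⟩⟩
  refine measure_mono_null hsub (measure_iUnion_null fun Q => measure_iUnion_null fun a => ?_)
  rw [← measureReal_eq_zero_iff]
  refine le_antisymm (hμ.measureReal_le (isClopen_patternCylinder Q a) ?_) measureReal_nonneg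
  obtain ⟨F₀, hF₀⟩ := exists_forall_finiteW_exists_subshiftW hΔ Q
  filter_upwards [hF.eventually_ge_atTop F₀] with k hk
  rw [extendMeasure_real_patternCylinder]
  refine (measureReal_eq_zero_of_forall_notMem (hν k).1 fun w hw hwW => ?_).le
  obtain ⟨x, hx, hxw⟩ := hF₀ (F k) hk w hwW
  exact a.2 ⟨x, hx, funext fun j => (hxw j j.2).trans (hw j)⟩

theorem subshiftW_nonempty
    (hΔ : ∀ F : Finset (IntLattice d), IsTopplingMatrix (productMatrix f g F)) :
    (subshiftW f g).Nonempty := by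
  obtain ⟨F₀, hF₀⟩ := exists_forall_finiteW_exists_subshiftW hΔ ∅
  obtain ⟨w, hw⟩ := finiteW_nonempty hΔ F₀
  obtain ⟨x, hx, -⟩ := hF₀ F₀ subset_rfl w hw
  exact ⟨x, hx⟩

theorem ncard_patterns_pos
    (hΔ : ∀ F : Finset (IntLattice d), IsTopplingMatrix (productMatrix f g F))
    (Q : Finset (IntLattice d)) : 0 < (patterns (subshiftW f g) Q).ncard :=
  (Set.ncard_pos (patterns_subshiftW_finite f g Q)).2 ((subshiftW_nonempty hΔ).image _)

theorem partitionEntropy_coordinate (μ : Measure (Config d)) (N : ℕ) :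
    partitionEntropy μ (fun v => v 0) N =
      ∑' a : cube d N → ℤ, Real.negMulLog (μ.real (patternCylinder (cube d N) a)) := by
  simp [partitionEntropy, patternCylinder, configShift]

theorem real_patternCylinder_eq_zero {μ : Measure (Config d)} [IsProbabilityMeasure μ]
    {Y : Set (Config d)} (hY : μ Yᶜ = 0) {Q : Finset (IntLattice d)} {a : Q → ℤ}
    (ha : a ∉ patterns Y Q) : μ.real (patternCylinder Q a) = 0 :=
  measureReal_eq_zero_of_forall_notMem hY fun v hv hvY => ha ⟨v, hvY, funext hv⟩

theorem sum_real_patternCylinder {μ : Measure (Config d)} [IsProbabilityMeasure μ]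
    {Y : Set (Config d)} (hY : μ Yᶜ = 0) {Q : Finset (IntLattice d)}
    (hfin : (patterns Y Q).Finite) :
    ∑ a ∈ hfin.toFinset, μ.real (patternCylinder Q a) = 1 := by
  have h1 := sum_measureReal_preimage_singleton (μ := μ) hfin.toFinset
    (f := fun (v : Config d) (j : Q) => v j) (fun a _ => by
      convert measurableSet_patternCylinder Q a using 1
      ext v
      exact funext_iff)
  have h2 : μ.real ((fun (v : Config d) (j : Q) => v j) ⁻¹' hfin.toFinset) = 1 := by
    have h3 : μ.real ((fun (v : Config d) (j : Q) => v j) ⁻¹' hfin.toFinset)ᶜ = 0 := by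
      refine measureReal_eq_zero_of_forall_notMem hY fun v hv hvY => hv ?_
      simpa using ⟨v, hvY, rfl⟩
    have h4 : Measurable fun (v : Config d) (j : Q) => v j :=
      measurable_pi_lambda _ fun j => measurable_pi_apply _
    have h5 := probReal_compl_eq_one_sub (μ := μ) (h4 (hfin.toFinset.measurableSet))
    linarith
  rw [← h2, ← h1]
  refine Finset.sum_congr rfl fun a _ => congrArg _ ?_
  ext v
  exact funext_iff.symm

theorem partitionEntropy_coordinate_eq_sum {μ : Measure (Config d)} [IsProbabilityMeasure μ]
    {Y : Set (Config d)} (hY : μ Yᶜ = 0) {N : ℕ} (hfin : (patterns Y (cube d N)).Finite) :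
    partitionEntropy μ (fun v => v 0) N =
      ∑ a ∈ hfin.toFinset, Real.negMulLog (μ.real (patternCylinder (cube d N) a)) := by
  rw [partitionEntropy_coordinate, tsum_eq_sum]
  intro a ha
  rw [real_patternCylinder_eq_zero hY (by simpa using ha), Real.negMulLog_zero]

theorem partitionEntropy_coordinate_le {μ : Measure (Config d)} [IsProbabilityMeasure μ]
    {Y : Set (Config d)} (hY : μ Yᶜ = 0) {N : ℕ} (hfin : (patterns Y (cube d N)).Finite) :
    partitionEntropy μ (fun v => v 0) N ≤ Real.log (patterns Y (cube d N)).ncard := by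
  rw [partitionEntropy_coordinate_eq_sum hY hfin, Set.ncard_eq_toFinset_card _ hfin]
  exact sum_negMulLog_le_log_card (fun _ _ => measureReal_nonneg)
    (sum_real_patternCylinder hY hfin)

theorem le_partitionEntropy_limit
    (hΔ : ∀ F : Finset (IntLattice d), IsTopplingMatrix (productMatrix f g F))
    (hF : Tendsto F atTop atTop)
    (hν : ∀ k, IsSandpileHaar (productMatrix f g (F k)) (finiteW f g (F k)) (ν k))
    (hμ : MapClusterPt μ atTop (fun k => extendMeasure (F k) (ν k)))
    {N : ℕ} {D : Finset (IntLattice d)} (hD : IsInner g (f * g) (cube d N) D)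
    (hcodes : 0 < (siteCodes f g).card) :
    Real.log (patterns (subshiftW f g) (cube d N)).ncard -
        (cube d N \ D).card * Real.log (siteCodes f g).card ≤
      partitionEntropy (μ : Measure (Config d)) (fun v => v 0) N := by
  have hY := limit_subshiftW_compl hΔ hF hν hμ
  have hfin := patterns_subshiftW_finite f g (cube d N)
  have hpos := ncard_patterns_pos hΔ (cube d N)
  rw [partitionEntropy_coordinate_eq_sum hY hfin]
  refine Eq.trans_le ?_ (le_sum_negMulLog (fun _ _ => measureReal_nonneg)
    (sum_real_patternCylinder hY hfin)
    (fun a _ => limit_real_patternCylinder_mul_le hΔ hF hν hμ hD hpos a))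
  have h1 : ((siteCodes f g).card : ℝ) ≠ 0 := by exact_mod_cast hcodes.ne'
  have h2 : ((patterns (subshiftW f g) (cube d N)).ncard : ℝ) ≠ 0 := by exact_mod_cast hpos.ne'
  rw [Real.log_div (pow_ne_zero _ h1) h2, Real.log_pow]
  ring

theorem card_siteCodes_pos (f g : LaurentPoly d) : 0 < (siteCodes f g).card := by
  refine Finset.card_pos.2 ⟨(0, 0), mem_siteCodes ?_ le_rfl ?_⟩
  · rw [abs_zero]
    exact add_nonneg (mul_nonneg (coeffNorm_nonneg _) (coeffNorm_nonneg _))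
      (mul_nonneg (coeffNorm_nonneg _) (preimageBound_nonneg f g))
  · exact mul_nonneg (coeffNorm_nonneg _) (coeffNorm_nonneg _)

end Limit

/-! ### Cubes: negligible boundaries and existence of the topological entropy. -/

section Cubes

variable {d : ℕ}

theorem mem_cube {N : ℕ} {n : IntLattice d} : n ∈ cube d N ↔ ∀ k, -(N : ℤ) ≤ n k ∧ n k ≤ N := by
  simp [cube]

theorem card_cube (d N : ℕ) : (cube d N).card = (2 * N + 1) ^ d := by
  rw [cube, Fintype.card_piFinset, Finset.prod_const, Finset.card_univ, Fintype.card_fin,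
    Int.card_Icc]
  congr 1
  omega

theorem card_cube_pos (d N : ℕ) : (0 : ℝ) < (cube d N).card := by
  rw [card_cube]
  positivity

theorem cube_mono {M N : ℕ} (h : M ≤ N) : cube d M ⊆ cube d N := fun n hn =>
  mem_cube.2 fun k => by
    have := mem_cube.1 hn k
    omega

theorem exists_subset_cube (E : Finset (IntLattice d)) : ∃ N, E ⊆ cube d N := by
  refine ⟨∑ n ∈ E, ∑ k, (n k).natAbs, fun n hn => mem_cube.2 fun k => ?_⟩
  have h1 : (n k).natAbs ≤ ∑ n ∈ E, ∑ k, (n k).natAbs :=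
    (Finset.single_le_sum (f := fun k => (n k).natAbs) (fun _ _ => Nat.zero_le _)
      (Finset.mem_univ k)).trans
    (Finset.single_le_sum (f := fun n : IntLattice d => ∑ k, (n k).natAbs)
      (fun _ _ => Nat.zero_le _) hn)
  omega

theorem exists_isInner_cube (g h : LaurentPoly d) :
    ∃ R : ℕ, ∀ N, R ≤ N → IsInner g h (cube d N) (cube d (N - R)) := by
  classical
  obtain ⟨R, hR⟩ := exists_subset_cube (g.coeff.support ∪ h.coeff.support)
  refine ⟨R, fun N hN => ⟨cube_mono (Nat.sub_le _ _), fun i hi j hj => mem_cube.2 fun k => ?_⟩⟩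
  have h1 := mem_cube.1 (hR (show i - j ∈ _ by simpa using hj)) k
  have h2 := mem_cube.1 hi k
  rw [Pi.sub_apply] at h1
  push_cast [hN] at h2
  omega

theorem tendsto_card_cube_div (d : ℕ) (R : ℕ) :
    Tendsto (fun N => ((cube d (N + R)).card : ℝ) / (cube d N).card) atTop (𝓝 1) := by
  have h1 : Tendsto (fun N : ℕ => ((2 * R + 1 : ℝ) + 2 * N) / (1 + 2 * N)) atTop (𝓝 (2 / 2)) :=
    tendsto_add_mul_div_add_mul_atTop_nhds _ _ _ two_ne_zero
  have h2 := h1.pow d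
  rw [div_self two_ne_zero, one_pow] at h2
  refine h2.congr fun N => ?_
  rw [card_cube, card_cube]
  push_cast
  rw [div_pow]
  congr 2 <;> ring

theorem tendsto_card_boundary_div (d : ℕ) (R : ℕ) :
    Tendsto (fun N => ((cube d N \ cube d (N - R)).card : ℝ) / (cube d N).card) atTop (𝓝 0) := by
  rw [← tendsto_add_atTop_iff_nat R]
  have h1 := ((tendsto_card_cube_div d R).inv₀ one_ne_zero).const_sub 1
  rw [inv_one, sub_self] at h1
  refine h1.congr fun N => ?_
  have hsub : cube d N ⊆ cube d (N + R) := cube_mono (Nat.le_add_right _ _)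
  rw [Nat.add_sub_cancel, Finset.card_sdiff_of_subset hsub,
    Nat.cast_sub (Finset.card_le_card hsub), sub_div, div_self (card_cube_pos _ _).ne', inv_div]

/-- A version of Fekete's lemma for cubes. -/
theorem exists_tendsto_div_card_cube {a : ℕ → ℝ} (ha : ∀ N, 0 ≤ a N)
    (h : ∀ M N : ℕ, a M ≤ (2 * M / (2 * N + 1) + 2 : ℝ) ^ d * a N) :
    ∃ r, Tendsto (fun N => a N / (cube d N).card) atTop (𝓝 r) := by
  have hbdd : BddBelow (Set.range fun N => a N / (cube d N).card) :=
    ⟨0, by rintro _ ⟨N, rfl⟩; exact div_nonneg (ha N) (card_cube_pos d N).le⟩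
  -- The limit is the infimum: for fixed `N` the bound on `a M` divided by |Q_M| tends to a N /
  -- |Q_N|.
  refine ⟨⨅ N, a N / (cube d N).card, tendsto_order.2 ⟨fun b hb => ?_, fun b hb => ?_⟩⟩
  · exact Eventually.of_forall fun N => hb.trans_le (ciInf_le hbdd N)
  · obtain ⟨N, hN⟩ := exists_lt_of_ciInf_lt hb
    have h1 : Tendsto (fun M : ℕ => ((2 : ℝ) + 2 / (2 * N + 1) * M) / (1 + 2 * M)) atTop
        (𝓝 (2 / (2 * N + 1) / 2)) :=
      tendsto_add_mul_div_add_mul_atTop_nhds _ _ _ two_ne_zero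
    have h2 := (h1.pow d).mul_const (a N)
    have h3 : (2 / (2 * N + 1) / 2 : ℝ) ^ d * a N = a N / (cube d N).card := by
      have h4 : (2 / (2 * N + 1) / 2 : ℝ) = (2 * (N : ℝ) + 1)⁻¹ := by field_simp
      rw [card_cube, h4, inv_pow, inv_mul_eq_div]
      push_cast
      rfl
    rw [h3] at h2
    filter_upwards [h2.eventually (gt_mem_nhds hN)] with M hM
    refine lt_of_le_of_lt ?_ hM
    rw [div_le_iff₀ (card_cube_pos d M)]
    refine (h M N).trans_eq ?_
    rw [card_cube, div_pow]
    push_cast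
    field_simp
    ring

theorem polyMul_configShift (g : LaurentPoly d) (m : IntLattice d) (u : Config d) :
    polyMul g (configShift m u) = configShift m (polyMul g u) := by
  ext n
  simp [polyMul, configShift, sub_add_eq_add_sub]

theorem configShift_mem_subshiftW {f g : LaurentPoly d} {v : Config d} (hv : v ∈ subshiftW f g)
    (m : IntLattice d) : configShift m v ∈ subshiftW f g := by
  classical
  obtain ⟨⟨h1, h2⟩, u, ⟨C, hC⟩, rfl⟩ := hv
  refine ⟨⟨fun i => h1 (i + m), fun E hE => ?_⟩, configShift m u, ⟨C, fun n => hC (n + m)⟩,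
    (polyMul_configShift g m u).symm⟩
  obtain ⟨i, hi, hle⟩ := h2 (E.map (addRightEmbedding m)) (hE.map)
  obtain ⟨k, hk, rfl⟩ := Finset.mem_map.1 hi
  refine ⟨k, hk, ?_⟩
  rw [← Finset.map_erase, Finset.sum_map] at hle
  simpa [configShift] using hle

/-- Cover Q_M by the translates of Q_N by multiples of 2N + 1; at most 2M/(2N+1) + 2 of them are
needed in each direction, and shift invariance makes every block a pattern on Q_N. -/
theorem ncard_patterns_cube_le {Y : Set (Config d)}
    (hY : ∀ v ∈ Y, ∀ m, configShift m v ∈ Y) (hfin : ∀ Q, (patterns Y Q).Finite)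
    (hne : Y.Nonempty) (M N : ℕ) :
    (patterns Y (cube d M)).ncard ≤
      (patterns Y (cube d N)).ncard ^ (2 * M / (2 * N + 1) + 2) ^ d := by
  classical
  obtain ⟨T, hTd⟩ : ∃ T : Finset (IntLattice d), T = Fintype.piFinset fun _ =>
    Finset.Icc (((N : ℤ) - M) / (2 * N + 1)) (((N : ℤ) + M) / (2 * N + 1)) := ⟨_, rfl⟩
  have hc : (0 : ℤ) < 2 * N + 1 := by omega
  have hT : T.card ≤ (2 * M / (2 * N + 1) + 2) ^ d := by
    rw [hTd, Fintype.card_piFinset, Finset.prod_const, Finset.card_univ, Fintype.card_fin,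
      Int.card_Icc]
    refine Nat.pow_le_pow_left ?_ d
    have h1 : ((N : ℤ) + M) / (2 * N + 1) ≤
        ((N : ℤ) - M) / (2 * N + 1) + 2 * M / (2 * N + 1) + 1 := by
      refine Int.lt_add_one_iff.1 (Int.ediv_lt_of_lt_mul hc ?_)
      have h2 := Int.lt_ediv_add_one_mul_self ((N : ℤ) - M) hc
      have h3 := Int.lt_ediv_add_one_mul_self (2 * (M : ℤ)) hc
      nlinarith
    have h4 : 0 ≤ 2 * (M : ℤ) / (2 * N + 1) := Int.ediv_nonneg (by omega) hc.le
    zify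
    omega
  have hpos : 0 < (patterns Y (cube d N)).ncard := (Set.ncard_pos (hfin _)).2 (hne.image _)
  refine le_trans ?_ (Nat.pow_le_pow_right hpos hT)
  have hlift : ∀ b ∈ patterns Y (cube d M), ∃ v ∈ Y, ∀ j : cube d M, v j = b j := by
    rintro _ ⟨v, hv, rfl⟩
    exact ⟨v, hv, fun _ => rfl⟩
  choose! y hy hyb using hlift
  have hcard : (patterns Y (cube d N)).ncard ^ T.card =
      (Fintype.piFinset fun _ : T => (hfin (cube d N)).toFinset).card := by
    rw [Fintype.card_piFinset, Finset.prod_const, Finset.card_univ, Fintype.card_coe,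
      Set.ncard_eq_toFinset_card _ (hfin _)]
  rw [hcard, ← Set.ncard_coe_finset]
  refine Set.ncard_le_ncard_of_injOn
    (fun b (t : T) (j : cube d N) => y b (j + (2 * N + 1 : ℤ) • (t : IntLattice d))) ?_ ?_
    (Finset.finite_toSet _)
  · intro b hb
    rw [Finset.mem_coe, Fintype.mem_piFinset]
    intro t
    rw [Set.Finite.mem_toFinset]
    exact ⟨_, hY (y b) (hy b hb) ((2 * N + 1 : ℤ) • (t : IntLattice d)), rfl⟩
  · intro b hb c hcP hbc
    funext i
    rw [← hyb b hb i, ← hyb c hcP i]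
    have hi := mem_cube.1 i.2
    -- Division of i + N by 2N + 1: the quotient names the block, the remainder minus N the position
    -- in Q_N.
    let t : IntLattice d := fun k => ((i : IntLattice d) k + N) / (2 * N + 1)
    have ht : t ∈ T := by
      rw [hTd, Fintype.mem_piFinset]
      intro k
      rw [Finset.mem_Icc]
      exact ⟨Int.ediv_le_ediv hc (by linarith [(hi k).1]),
        Int.ediv_le_ediv hc (by linarith [(hi k).2])⟩
    have hj : (i : IntLattice d) - (2 * N + 1 : ℤ) • t ∈ cube d N := by
      rw [mem_cube]
      intro k
      have h1 := Int.emod_nonneg ((i : IntLattice d) k + N) hc.ne'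
      have h2 := Int.emod_lt_of_pos ((i : IntLattice d) k + N) hc
      have h3 := Int.emod_add_mul_ediv ((i : IntLattice d) k + N) (2 * N + 1)
      simp only [Pi.sub_apply, Pi.smul_apply, smul_eq_mul, t]
      constructor <;> linarith
    have h4 := congrFun (congrFun hbc ⟨t, ht⟩) ⟨_, hj⟩
    simpa using h4

theorem exists_isTopologicalEntropy {Y : Set (Config d)}
    (hY : ∀ v ∈ Y, ∀ m, configShift m v ∈ Y) (hfin : ∀ Q, (patterns Y Q).Finite)
    (hne : Y.Nonempty) : ∃ r, IsTopologicalEntropy Y r := by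
  have hpos : ∀ N, 0 < (patterns Y (cube d N)).ncard := fun N =>
    (Set.ncard_pos (hfin _)).2 (hne.image _)
  refine exists_tendsto_div_card_cube (a := fun N => Real.log (patterns Y (cube d N)).ncard)
    (fun N => Real.log_natCast_nonneg _) fun M N => ?_
  have h1 : Real.log (patterns Y (cube d M)).ncard ≤
      ((2 * M / (2 * N + 1) + 2) ^ d : ℕ) * Real.log (patterns Y (cube d N)).ncard := by
    rw [← Real.log_pow]
    refine Real.log_le_log (by exact_mod_cast hpos M) ?_
    exact_mod_cast ncard_patterns_cube_le hY hfin hne M N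
  refine h1.trans (mul_le_mul_of_nonneg_right ?_ (Real.log_natCast_nonneg _))
  push_cast
  refine pow_le_pow_left₀ (by positivity) ?_ d
  have h2 : (((2 * M / (2 * N + 1) : ℕ)) : ℝ) ≤ _ := Nat.cast_div_le
  push_cast at h2
  linarith

theorem IsTopologicalEntropy.tendsto {Y : Set (Config d)} {r : ℝ}
    (h : IsTopologicalEntropy Y r) :
    Tendsto (fun N => Real.log (patterns Y (cube d N)).ncard / (cube d N).card) atTop (𝓝 r) := h

theorem IsTopologicalEntropy.tendsto_add {Y : Set (Config d)} {r : ℝ}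
    (h : IsTopologicalEntropy Y r) (R : ℕ) :
    Tendsto (fun N => Real.log (patterns Y (cube d (N + R))).ncard / (cube d N).card)
      atTop (𝓝 r) := by
  have h1 := (h.tendsto.comp (tendsto_add_atTop_nat R)).mul (tendsto_card_cube_div d R)
  rw [mul_one] at h1
  refine h1.congr fun N => ?_
  exact div_mul_div_cancel₀ (card_cube_pos d (N + R)).ne'

/-- The correction of the boundary in the counting estimates is negligible. -/
theorem tendsto_of_boundary_le {a b : ℕ → ℝ} {r c : ℝ} {R : ℕ}
    (ha : Tendsto (fun N => a N / (cube d N).card) atTop (𝓝 r))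
    (hle : ∀ᶠ N in atTop, a N - (cube d N \ cube d (N - R)).card * c ≤ b N)
    (hge : ∀ᶠ N in atTop, b N ≤ a N + (cube d N \ cube d (N - R)).card * c) :
    Tendsto (fun N => b N / (cube d N).card) atTop (𝓝 r) := by
  have h0 := (tendsto_card_boundary_div d R).mul_const c
  rw [zero_mul] at h0
  have h1 := ha.sub h0
  have h2 := ha.add h0
  rw [sub_zero] at h1
  rw [add_zero] at h2
  refine tendsto_of_tendsto_of_tendsto_of_le_of_le' h1 h2 ?_ ?_
  · filter_upwards [hle] with N hN
    rw [le_div_iff₀ (card_cube_pos d N)]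
    refine Eq.trans_le ?_ hN
    have := (card_cube_pos d N).ne'
    field_simp
  · filter_upwards [hge] with N hN
    rw [div_le_iff₀ (card_cube_pos d N)]
    refine hN.trans_eq ?_
    have := (card_cube_pos d N).ne'
    field_simp

end Cubes

/-! ### Entropy of arbitrary finite partitions. -/

section Variational

variable {d : ℕ}

theorem measurable_configShift (m : IntLattice d) : Measurable (configShift m) :=
  measurable_pi_lambda _ fun n => measurable_pi_apply (n + m)

/-- A finite measurable partition is approximated by partitions which only depend on the
coordinates in a finite window. -/
theorem exists_window_approx (ρ : Measure (Config d)) [IsProbabilityMeasure ρ] {k : ℕ}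
    {P : Config d → Fin k} (hP : Measurable P) {ε : ℝ} (hε : 0 < ε) :
    ∃ (R : ℕ) (P' : Config d → Fin k) (B : Set (Config d)), MeasurableSet B ∧ ρ.real B ≤ ε ∧
      (∀ v ∉ B, P v = P' v) ∧ ∀ v v' : Config d, (∀ i ∈ cube d R, v i = v' i) → P' v = P' v' := by
  classical
  have hε' : 0 < ε / (k + 1) := by positivity
  have happ : ∀ i : Fin k, ∃ t ∈ measurableCylinders fun _ : IntLattice d => ℤ,
      ρ (symmDiff t (P ⁻¹' {i})) < ENNReal.ofReal (ε / (k + 1)) := fun i =>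
    exists_measure_symmDiff_lt_of_generateFrom_isSetRing isSetRing_measurableCylinders
      ⟨{Set.univ}, Set.countable_singleton _,
        Set.singleton_subset_iff.2 (univ_mem_measurableCylinders _), by simp⟩
      generateFrom_measurableCylinders.symm (hP (measurableSet_singleton i))
      (ENNReal.ofReal_pos.2 hε')
  choose A hA hAρ using happ
  choose s S hS hAS using fun i => (mem_measurableCylinders _).1 (hA i)
  obtain ⟨R, hR⟩ := exists_subset_cube (Finset.univ.biUnion s)
  -- Outside the exceptional set exactly one approximating cylinder contains `v`, and `sel` returns
  -- its label; the default value matters only on that set.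
  let sel : Set (Fin k) → Fin k := fun t => if h : t.Nonempty then h.choose else P 0
  refine ⟨R, fun v => sel {i | v ∈ A i}, ⋃ i, symmDiff (A i) (P ⁻¹' {i}),
    MeasurableSet.iUnion fun i => ?_, ?_, fun v hv => ?_, fun v v' hvv' => ?_⟩
  · rw [hAS i]
    exact (MeasurableSet.cylinder _ (hS i)).symmDiff (hP (measurableSet_singleton i))
  · refine (measureReal_iUnion_fintype_le _).trans ?_
    have h1 : ∀ i, ρ.real (symmDiff (A i) (P ⁻¹' {i})) ≤ ε / (k + 1) := fun i =>
      ENNReal.toReal_le_of_le_ofReal hε'.le (hAρ i).le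
    refine (Finset.sum_le_sum fun i _ => h1 i).trans ?_
    rw [Finset.sum_const, Finset.card_univ, Fintype.card_fin, nsmul_eq_mul, ← mul_div_assoc,
      div_le_iff₀ (by positivity)]
    nlinarith
  · have h1 : {i | v ∈ A i} = {P v} := by
      ext i
      have h2 : v ∉ symmDiff (A i) (P ⁻¹' {i}) := fun h => hv (Set.mem_iUnion.2 ⟨i, h⟩)
      rw [Set.mem_symmDiff, Set.mem_preimage, Set.mem_singleton_iff] at h2
      rw [Set.mem_ofPred_eq, Set.mem_singleton_iff, eq_comm]
      tauto
    have h2 : ({P v} : Set (Fin k)).Nonempty := Set.singleton_nonempty _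
    simp only [h1, sel, dif_pos h2]
    exact h2.choose_spec.symm
  · refine congrArg sel ?_
    ext i
    rw [Set.mem_ofPred_eq, Set.mem_ofPred_eq, hAS i, mem_cylinder, mem_cylinder]
    have h1 : (s i).restrict v = (s i).restrict v' := by
      funext j
      exact hvv' j (hR (Finset.mem_biUnion.2 ⟨i, Finset.mem_univ i, j.2⟩))
    rw [h1]

theorem ncard_windowNames_le {Y : Set (Config d)} (hfin : ∀ Q, (patterns Y Q).Finite) {α : Type*}
    {R : ℕ} {P' : Config d → α}
    (hP' : ∀ v v' : Config d, (∀ i ∈ cube d R, v i = v' i) → P' v = P' v') (N : ℕ) :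
    ((fun (v : Config d) (j : cube d N) => P' (configShift j v)) '' Y).ncard ≤
      (patterns Y (cube d (N + R))).ncard := by
  let G : (cube d (N + R) → ℤ) → cube d N → α := fun b j =>
    P' (configShift j (extendZero (cube d (N + R)) b))
  have h1 : (fun (v : Config d) (j : cube d N) => P' (configShift j v)) '' Y ⊆
      G '' patterns Y (cube d (N + R)) := by
    rintro _ ⟨v, hv, rfl⟩
    refine ⟨_, ⟨v, hv, rfl⟩, funext fun j => hP' _ _ fun i hi => ?_⟩
    have h2 : i + (j : IntLattice d) ∈ cube d (N + R) := mem_cube.2 fun k => by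
      have h3 := mem_cube.1 hi k
      have h4 := mem_cube.1 j.2 k
      rw [Pi.add_apply]
      push_cast
      omega
    simp [configShift, extendZero, h2]
  exact (Set.ncard_le_ncard h1 ((hfin _).image G)).trans (Set.ncard_image_le (hfin _))

/-- Gibbs' inequality against a noisy model: pick a `P'`-name of a point of `Y` uniformly, then
weight each letter by 1 - δ if kept and δ/k if altered. The cost is the log of the number of names,
-log(1 - δ) per site, and log(k/δ) per mismatch; by invariance mismatches have expected density at
most ρ(B). -/
theorem partitionEntropy_le_of_approx {ρ : Measure (Config d)} [IsProbabilityMeasure ρ]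
    (hρ : IsShiftInvariant ρ) {Y : Set (Config d)} (hρY : ρ Yᶜ = 0)
    (hfin : ∀ Q, (patterns Y Q).Finite) {k : ℕ} {P : Config d → Fin k} (hP : Measurable P)
    {R : ℕ} {P' : Config d → Fin k} {B : Set (Config d)} (hB : MeasurableSet B)
    (hPB : ∀ v ∉ B, P v = P' v)
    (hP' : ∀ v v' : Config d, (∀ i ∈ cube d R, v i = v' i) → P' v = P' v')
    {δ : ℝ} (hδ : 0 < δ) (hδ1 : δ < 1) (N : ℕ) :
    partitionEntropy ρ P N ≤ Real.log (patterns Y (cube d (N + R))).ncard +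
      (cube d N).card * (-Real.log (1 - δ) + Real.log (k / δ) * ρ.real B) := by
  classical
  have hk : 0 < k := (P 0).pos
  have hk' : (1 : ℝ) ≤ k := by exact_mod_cast hk
  have hY : Y.Nonempty := by
    by_contra h
    rw [Set.not_nonempty_iff_eq_empty.1 h, Set.compl_empty, measure_univ] at hρY
    exact one_ne_zero hρY
  let name : Config d → cube d N → Fin k := fun v j => P (configShift j v)
  let name' : Config d → cube d N → Fin k := fun v j => P' (configShift j v)
  have hname : Measurable name :=
    measurable_pi_lambda _ fun j => hP.comp (measurable_configShift _)
  let C : Finset (cube d N → Fin k) := (Set.toFinite (name' '' Y)).toFinset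
  have hCcard : C.card = (name' '' Y).ncard := (Set.ncard_eq_toFinset_card _ _).symm
  have hC0 : (0 : ℝ) < C.card := by
    rw [hCcard]
    exact_mod_cast (Set.ncard_pos (Set.toFinite _)).2 (hY.image _)
  have hClog : Real.log C.card ≤ Real.log (patterns Y (cube d (N + R))).ncard := by
    refine Real.log_le_log hC0 ?_
    rw [hCcard]
    exact_mod_cast ncard_windowNames_le hfin hP' N
  let t : Fin k → Fin k → ℝ := fun a c => if a = c then 1 - δ else δ / k
  have htpos : ∀ a c, 0 < t a c := fun a c => by
    simp only [t]
    split_ifs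
    · linarith
    · positivity
  have htsum : ∀ c, ∑ a, t a c ≤ 1 := fun c => by
    have h1 : ∀ a, t a c ≤ (if a = c then 1 - δ else 0) + δ / k := fun a => by
      simp only [t]
      split_ifs
      · have : 0 < δ / k := by positivity
        linarith
      · simp
    refine (Finset.sum_le_sum fun a _ => h1 a).trans ?_
    rw [Finset.sum_add_distrib, Finset.sum_ite_eq', if_pos (Finset.mem_univ c), Finset.sum_const,
      Finset.card_univ, Fintype.card_fin, nsmul_eq_mul, mul_div_cancel₀ _ (by positivity)]
    linarith
  let q : (cube d N → Fin k) → ℝ := fun a => (∑ c ∈ C, ∏ j, t (a j) (c j)) / C.card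
  have hterm : ∀ a c : cube d N → Fin k, 0 < ∏ j, t (a j) (c j) := fun a c =>
    Finset.prod_pos fun j _ => htpos _ _
  have hqpos : ∀ a, 0 < q a := fun a =>
    div_pos (Finset.sum_pos (fun c _ => hterm a c) (Finset.card_pos.1 (by exact_mod_cast hC0))) hC0
  have hqsum : ∑ a, q a ≤ 1 := by
    rw [← Finset.sum_div, div_le_one hC0, Finset.sum_comm]
    refine (Finset.sum_le_sum (g := fun _ => (1 : ℝ)) fun c _ => ?_).trans (by simp)
    have h1 := Finset.prod_univ_sum (fun _ : cube d N => (Finset.univ : Finset (Fin k)))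
      (fun j x => t x (c j))
    rw [Fintype.piFinset_univ] at h1
    rw [← h1]
    exact Finset.prod_le_one (fun j _ => Finset.sum_nonneg fun a _ => (htpos _ _).le)
      fun j _ => htsum _
  have hpre : ∀ a, {v | ∀ j : cube d N, P (configShift j v) = a j} = name ⁻¹' {a} := fun a => by
    ext v
    exact funext_iff.symm
  have hpsum : ∑ a, ρ.real (name ⁻¹' {a}) = 1 := by
    rw [sum_measureReal_preimage_singleton _ fun a _ => hname (measurableSet_singleton a)]
    simp
  have hent : partitionEntropy ρ P N = ∑ a, Real.negMulLog (ρ.real (name ⁻¹' {a})) := by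
    rw [partitionEntropy, tsum_fintype]
    exact Finset.sum_congr rfl fun a _ => by rw [hpre a]
  have hint : ∑ a, ρ.real (name ⁻¹' {a}) * -Real.log (q a) = ∫ v, -Real.log (q (name v)) ∂ρ := by
    have h1 := integral_map (μ := ρ) hname.aemeasurable (f := fun a => -Real.log (q a))
      (measurable_of_countable _).aestronglyMeasurable
    have := Measure.isProbabilityMeasure_map (μ := ρ) hname.aemeasurable
    rw [← h1, integral_fintype (Integrable.of_finite)]
    refine Finset.sum_congr rfl fun a _ => ?_
    rw [map_measureReal_apply hname (measurableSet_singleton a), smul_eq_mul]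
  set c := Real.log (k / δ) with hc
  have hc0 : 0 ≤ c := Real.log_nonneg (by rw [le_div_iff₀ hδ]; linarith)
  have hlog0 : 0 ≤ -Real.log (1 - δ) := by
    have := Real.log_nonpos (x := 1 - δ) (by linarith) (by linarith)
    linarith
  have hsite : ∀ w, -Real.log (t (P w) (P' w)) ≤ -Real.log (1 - δ) + B.indicator (fun _ => c) w := by
    intro w
    by_cases hw : P w = P' w
    · have h1 : 0 ≤ B.indicator (fun _ => c) w := Set.indicator_nonneg (fun _ _ => hc0) w
      simp only [t, if_pos hw]
      linarith
    · have h1 : w ∈ B := by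
        by_contra h
        exact hw (hPB w h)
      simp only [t, if_neg hw, Set.indicator_of_mem h1]
      rw [← Real.log_inv, inv_div, ← hc]
      linarith
  have hpoint : ∀ v ∈ Y, -Real.log (q (name v)) ≤
      (Real.log C.card + (cube d N).card * -Real.log (1 - δ)) +
        ∑ j : cube d N, B.indicator (fun _ => c) (configShift j v) := by
    intro v hv
    -- Only the summand of the own `P'`-name of `v` is kept from the mixture.
    have h1 : (∏ j, t (name v j) (name' v j)) / C.card ≤ q (name v) := by
      refine div_le_div_of_nonneg_right ?_ hC0.le
      refine Finset.single_le_sum (f := fun c : cube d N → Fin k => ∏ j, t (name v j) (c j))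
        (fun c _ => (hterm _ c).le) ?_
      exact (Set.Finite.mem_toFinset _).2 ⟨v, hv, rfl⟩
    have h2 := Real.log_le_log (div_pos (hterm _ _) hC0) h1
    rw [Real.log_div (hterm _ _).ne' hC0.ne', Real.log_prod fun j _ => (htpos _ _).ne'] at h2
    have h3 := Finset.sum_le_sum fun (j : cube d N) (_ : j ∈ Finset.univ) =>
      hsite (configShift j v)
    rw [Finset.sum_add_distrib, Finset.sum_const, Finset.card_univ, Fintype.card_coe,
      nsmul_eq_mul, Finset.sum_neg_distrib] at h3
    simp only [name, name'] at h2
    linarith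
  have hind : ∀ j : IntLattice d, Integrable (fun v => B.indicator (fun _ => c) (configShift j v)) ρ ∧
      ∫ v, B.indicator (fun _ => c) (configShift j v) ∂ρ = c * ρ.real B := by
    intro j
    have h1 : (fun v => B.indicator (fun _ => c) (configShift j v)) =
        (configShift j ⁻¹' B).indicator fun _ => c := rfl
    have h2 := measurable_configShift j hB
    refine ⟨h1 ▸ (integrable_const c).indicator h2, ?_⟩
    rw [h1, integral_indicator_const _ h2, ← map_measureReal_apply (measurable_configShift j) hB,
      hρ j, smul_eq_mul, mul_comm]
  rw [hent]
  refine (sum_negMulLog_le (fun _ _ => measureReal_nonneg) (fun a _ => hqpos a)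
    (hqsum.trans_eq hpsum.symm)).trans ?_
  rw [hint]
  have hIsum : Integrable (fun v => ∑ j : cube d N,
      B.indicator (fun _ => c) (configShift (j : IntLattice d) v)) ρ :=
    integrable_finsetSum _ fun j _ => (hind j).1
  have hae : ∀ᵐ v ∂ρ, v ∈ Y := mem_ae_iff.2 hρY
  refine (integral_mono_ae ?_ ((integrable_const _).add hIsum) (hae.mono hpoint)).trans ?_
  · have := Measure.isProbabilityMeasure_map (μ := ρ) hname.aemeasurable
    exact (Integrable.of_finite (μ := ρ.map name) (f := fun a => -Real.log (q a))).comp_measurable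
      hname
  · simp only [Pi.add_apply]
    rw [integral_add (integrable_const _) hIsum, integral_finsetSum _ fun (j : cube d N) _ => (hind j).1,
      Finset.sum_congr rfl fun (j : cube d N) _ => (hind j).2, integral_const, Finset.sum_const,
      Finset.card_univ, Fintype.card_coe, probReal_univ, one_smul, nsmul_eq_mul, mul_add]
    linarith

/-- Entropy rates of finite partitions are bounded by the topological entropy. -/
theorem IsEntropyRate.le_topologicalEntropy {ρ : Measure (Config d)} [IsProbabilityMeasure ρ]
    (hρ : IsShiftInvariant ρ) {Y : Set (Config d)} (hρY : ρ Yᶜ = 0)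
    (hfin : ∀ Q, (patterns Y Q).Finite) {r s : ℝ} (hr : IsTopologicalEntropy Y r) {k : ℕ}
    {P : Config d → Fin k} (hP : Measurable P) (hs : IsEntropyRate ρ P s) : s ≤ r := by
  have hk' : (1 : ℝ) ≤ k := by exact_mod_cast (P 0).pos
  have key : ∀ δ : ℝ, 0 < δ → δ < 1 → s ≤ r + (-Real.log (1 - δ) + δ) := by
    intro δ hδ hδ1
    have hc0 : 0 ≤ Real.log (k / δ) := Real.log_nonneg (by rw [le_div_iff₀ hδ]; linarith)
    -- ε is chosen so that the mismatch cost log(k/δ)·ρ(B) is at most δ; afterwards N → ∞, then δ →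
    -- 0.
    obtain ⟨R, P', B, hB, hBε, hPB, hP'⟩ := exists_window_approx ρ hP
      (ε := δ / (Real.log (k / δ) + 1)) (by positivity)
    have h1 : Real.log (k / δ) * ρ.real B ≤ δ := by
      rw [le_div_iff₀ (by positivity)] at hBε
      have : 0 ≤ ρ.real B := measureReal_nonneg
      nlinarith
    refine le_of_tendsto_of_tendsto' hs ((hr.tendsto_add R).add_const _) fun N => ?_
    rw [div_le_iff₀ (card_cube_pos d N), add_mul, div_mul_cancel₀ _ (card_cube_pos d N).ne']
    refine (partitionEntropy_le_of_approx hρ hρY hfin hP hB hPB hP' hδ hδ1 N).trans ?_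
    have := mul_le_mul_of_nonneg_left h1 (card_cube_pos d N).le
    linarith
  have hlim : Tendsto (fun δ : ℝ => r + (-Real.log (1 - δ) + δ)) (𝓝[>] 0) (𝓝 r) := by
    have h1 : ContinuousAt (fun δ : ℝ => r + (-Real.log (1 - δ) + δ)) 0 := by
      have : ContinuousAt (fun δ : ℝ => Real.log (1 - δ)) 0 :=
        (continuousAt_const.sub continuousAt_id).log (by norm_num)
      exact continuousAt_const.add (this.neg.add continuousAt_id)
    have h2 := h1.tendsto
    simp only [sub_zero, Real.log_one, neg_zero, add_zero] at h2
    exact h2.mono_left nhdsWithin_le_nhds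
  refine ge_of_tendsto hlim ?_
  filter_upwards [self_mem_nhdsWithin, nhdsWithin_le_nhds (Iio_mem_nhds one_pos)] with δ h1 h2
  exact key δ h1 h2

/-- The partition into the values at the origin is, up to a null set, a finite partition. -/
theorem exists_finite_partition_of_coordinate {μ : Measure (Config d)} {Y : Set (Config d)}
    (hμY : μ Yᶜ = 0) {k : ℕ} (hk : 0 < k) (hY : ∀ v ∈ Y, ∀ i, 0 ≤ v i ∧ v i < k) :
    ∃ P : Config d → Fin k, Measurable P ∧
      ∀ N, partitionEntropy μ P N = partitionEntropy μ (fun v => v 0) N := by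
  classical
  let G : ℤ → Fin k := fun z => if h : z.toNat < k then ⟨z.toNat, h⟩ else ⟨0, hk⟩
  have hG : ∀ z : ℤ, 0 ≤ z → z < k → ((G z : ℕ) : ℤ) = z := fun z h0 h1 => by
    have h2 : z.toNat < k := by omega
    simp only [G, dif_pos h2]
    omega
  have hae : ∀ᵐ v ∂μ, v ∈ Y := mem_ae_iff.2 hμY
  refine ⟨fun v => G (v 0), (measurable_of_countable G).comp (measurable_pi_apply 0), fun N => ?_⟩
  have hinj : Function.Injective fun (b : cube d N → Fin k) (j : cube d N) => ((b j : ℕ) : ℤ) := by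
    intro b c h
    funext j
    have h1 : ((b j : ℕ) : ℤ) = ((c j : ℕ) : ℤ) := congrFun h j
    exact Fin.ext (by exact_mod_cast h1)
  -- Integer names not coming from letters of `Fin k` have mass zero, so the sum over them drops
  -- out.
  rw [partitionEntropy, partitionEntropy, ← hinj.tsum_eq]
  · refine tsum_congr fun b => congrArg _ (measureReal_congr ?_)
    filter_upwards [hae] with v hv
    refine propext (forall_congr' fun j => ?_)
    have h1 := hY v hv (0 + j)
    change G (v (0 + j)) = b j ↔ v (0 + j) = ((b j : ℕ) : ℤ)
    have h2 := hG _ h1.1 h1.2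
    rw [Fin.ext_iff]
    omega
  · intro a ha
    rw [Function.mem_support] at ha
    by_contra hcon
    refine ha ?_
    rw [measureReal_eq_zero_of_forall_notMem hμY fun v hv hvY => hcon ?_, Real.negMulLog_zero]
    refine ⟨fun j => G (v (0 + j)), funext fun j => ?_⟩
    have h1 := hY v hvY (0 + j)
    exact (hG _ h1.1 h1.2).trans (hv j)

end Variational

/-! ### Assembly of the theorem. -/

theorem mainTheorem5 (d : ℕ) (hd : 1 ≤ d) (f g : LaurentPoly d) (hfg : IsRelPrime f g)
    (hΔ : ∀ F : Finset (IntLattice d), IsTopplingMatrix (productMatrix f g F))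
    (F : ℕ → Finset (IntLattice d)) (hF : Tendsto F atTop atTop)
    (ν : ∀ k, ProbabilityMeasure (F k → ℤ))
    (hν : ∀ k, IsSandpileHaar (productMatrix f g (F k)) (finiteW f g (F k)) (ν k))
    (μ : ProbabilityMeasure (Config d))
    (hμ : MapClusterPt μ atTop (fun k => extendMeasure (F k) (ν k))) :
    ∃ hTop ℓ : ℝ,
      IsTopologicalEntropy (subshiftW f g) hTop ∧
      (μ : Measure (Config d)) (subshiftW f g)ᶜ = 0 ∧
      IsEntropyRate (μ : Measure (Config d)) (fun v => v 0) hTop ∧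
      (IsShiftInvariant (μ : Measure (Config d)) →
        IsKSEntropy (μ : Measure (Config d)) hTop) ∧
      (∀ (ρ : ProbabilityMeasure (Config d)) (r : ℝ),
        (ρ : Measure (Config d)) (subshiftW f g)ᶜ = 0 →
        IsShiftInvariant (ρ : Measure (Config d)) →
        IsKSEntropy (ρ : Measure (Config d)) r → r ≤ hTop) ∧
      Tendsto (fun N : ℕ =>
        Real.log ((finiteW f g (cube d N)).ncard : ℝ) / (cube d N).card) atTop (𝓝 ℓ) ∧
      hTop ≤ ℓ := by
  have hfin := patterns_subshiftW_finite f g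
  have hshift := fun v (hv : v ∈ subshiftW f g) m => configShift_mem_subshiftW hv m
  obtain ⟨r, hr⟩ := exists_isTopologicalEntropy hshift hfin (subshiftW_nonempty hΔ)
  obtain ⟨R, hR⟩ := exists_isInner_cube g (f * g)
  have hμY := limit_subshiftW_compl hΔ hF hν hμ
  have hcodes : (1 : ℝ) ≤ (siteCodes f g).card := by exact_mod_cast card_siteCodes_pos f g
  have hlog : 0 ≤ Real.log (siteCodes f g).card := Real.log_nonneg hcodes
  have hrate : IsEntropyRate (μ : Measure (Config d)) (fun v => v 0) r := by
    refine tendsto_of_boundary_le (R := R) (c := Real.log (siteCodes f g).card) hr.tendsto ?_ ?_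
    · filter_upwards [eventually_ge_atTop R] with N hN
      exact le_partitionEntropy_limit hΔ hF hν hμ (hR N hN) (card_siteCodes_pos f g)
    · exact Eventually.of_forall fun N =>
        (partitionEntropy_coordinate_le hμY (hfin _)).trans
          (le_add_of_nonneg_right (mul_nonneg (Nat.cast_nonneg _) hlog))
  have hbound : ∀ (ρ : ProbabilityMeasure (Config d)) (s : ℝ),
      (ρ : Measure (Config d)) (subshiftW f g)ᶜ = 0 →
      IsShiftInvariant (ρ : Measure (Config d)) →
      s ∈ {s | ∃ (k : ℕ) (P : Config d → Fin k), Measurable P ∧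
        IsEntropyRate (ρ : Measure (Config d)) P s} → s ≤ r := by
    rintro ρ s hρY hρ ⟨k, P, hP, hs⟩
    exact hs.le_topologicalEntropy hρ hρY hfin hr hP
  -- The two counting bounds give |W_{Q_N}| the same growth rate, so the final inequality holds with
  -- equality. The supremum defining the Kolmogorov–Sinai entropy is attained by the coordinate
  -- partition.
  refine ⟨r, r, hr, hμY, hrate, fun hinv => ⟨fun s hs => hbound μ s hμY hinv hs, fun b hb => ?_⟩,
    fun ρ s hρY hρ hs => hs.2 fun s hs => hbound ρ s hρY hρ hs, ?_, le_rfl⟩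
  · refine hb ?_
    obtain ⟨v, hv⟩ := subshiftW_nonempty hΔ
    have hpos := (hv.1.1 0).1.trans_lt (hv.1.1 0).2
    have hcast : (((f * g).coeff 0).toNat : ℤ) = (f * g).coeff 0 := Int.toNat_of_nonneg hpos.le
    obtain ⟨P, hP, hPN⟩ := exists_finite_partition_of_coordinate hμY
      (k := ((f * g).coeff 0).toNat) (by omega)
      (fun v hv i => by rw [hcast]; exact hv.1.1 i)
    exact ⟨_, P, hP, hrate.congr fun N => by rw [hPN N]⟩
  · refine tendsto_of_boundary_le (R := R) (c := Real.log (siteCodes f g).card) hr.tendsto ?_ ?_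
    · filter_upwards [eventually_ge_atTop R] with N hN
      have h0 : (0 : ℝ) < (finiteW f g (cube d N)).ncard := by
        exact_mod_cast (Set.ncard_pos (finiteW_finite _)).2 (finiteW_nonempty hΔ _)
      have h1 : ((patterns (subshiftW f g) (cube d N)).ncard : ℝ) ≤
          (finiteW f g (cube d N)).ncard *
            (siteCodes f g).card ^ (cube d N \ cube d (N - R)).card := by
        exact_mod_cast ncard_patterns_le hΔ (hR N hN)
      have h2 := Real.log_le_log (by exact_mod_cast ncard_patterns_pos hΔ _) h1
      rw [Real.log_mul h0.ne' (by positivity), Real.log_pow] at h2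
      linarith
    · filter_upwards [eventually_ge_atTop R] with N hN
      have h0 : (0 : ℝ) < (finiteW f g (cube d N)).ncard := by
        exact_mod_cast (Set.ncard_pos (finiteW_finite _)).2 (finiteW_nonempty hΔ _)
      have hp : (0 : ℝ) < (patterns (subshiftW f g) (cube d N)).ncard := by
        exact_mod_cast ncard_patterns_pos hΔ _
      have h1 : ((finiteW f g (cube d N)).ncard : ℝ) ≤
          (patterns (subshiftW f g) (cube d N)).ncard *
            (siteCodes f g).card ^ (cube d N \ cube d (N - R)).card := by
        exact_mod_cast ncard_finiteW_le hΔ (hR N hN)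
      have h2 := Real.log_le_log h0 h1
      rwa [Real.log_mul hp.ne' (by positivity), Real.log_pow] at h2
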